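/- Let $d\ge 1$ and $k\ge 3$. Let $X_1,X_2,\dots$ be i.i.d. random points in $\mathbb{R}^d$ with a bounded density $f$, and let $r_n>0$ ($n\ge1$) satisfy $nr_n^d\to0$. For each $n\ge 1$ let $N_n$ be a Poisson random variable with mean $n$, independent of $(X_i)_{i\ge1}$, and let $\mathcal{P}_n=\{X_1,\dots,X_{N_n}\}$, a Poisson process of intensity $nf(\cdot)$. Let $A\subseteq\mathbb{R}^d$ be open with $\mathrm{vol}(\partial A)=0$. With $B_r(x)$ the closed ball of radius $r$ about $x$, points $x_1,\dots,x_k$ form an empty $(k-1)$-simplex with respect to $r$ if $\bigcap_{j\ne j_0}B_r(x_j)\neq\emptyset$ for every $j_0\in\{1,\dots,k\}$, while $\bigcap_{j=1}^kB_r(x_j)=\emptyset$; let $h_r(x_1,\dots,x_k)$ be the indicator of this. Let $\widetilde S^P_{n,k,A}$ be the number of $k$-element subsets $\mathcal{Y}\subseteq\mathcal{P}_n$ which form an empty $(k-1)$-simplex with respect to $r_n$, whose left-most (lexicographically first) point lies in $A$, and which are isolated, that is, $|x-y|>2r_n$ for all $x\in\mathcal{Y}$ and $y\in\mathcal{P}_n\setminus\mathcal{Y}$.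 Put $$\mu_A:=\left(\int_A f(x)^k\,dx\right)\int_{(\mathbb{R}^d)^{k-1}}h_1(0,y_2,\dots,y_k)\,d(y_2,\dots,y_k).$$ Then $\widetilde S^P_{n,k,A}$ has a finite second moment for every $n\ge1$, and $$\lim_{n\to\infty}n^{-k}r_n^{-d(k-1)}\,\mathbb{E}\big[\widetilde S^P_{n,k,A}\big]=\lim_{n\to\infty}n^{-k}r_n^{-d(k-1)}\,\mathrm{Var}\big[\widetilde S^P_{n,k,A}\big]=\frac{\mu_A}{k!}.$$ -/

import Mathlib

open Filter Topology MeasureTheory ProbabilityTheory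

noncomputable section

namespace RandomCech

/-- The points `x j`, `j ∈ s`, form an empty simplex with respect to `r`: any family obtained by
leaving one of the points out has closed `r`-balls with a common point, but the closed `r`-balls
about all the points have no common point. (If `s` has `k` elements this is an empty
`(k - 1)`-simplex; the points are then automatically pairwise distinct.) -/
def IsEmptySimplex {d : ℕ} {ι : Type*} [DecidableEq ι] (r : ℝ) (s : Finset ι)
    (x : ι → EuclideanSpace ℝ (Fin d)) : Prop :=
  (∀ j₀ ∈ s, (⋂ j ∈ s.erase j₀, Metric.closedBall (x j) r).Nonempty) ∧
    (⋂ j ∈ s, Metric.closedBall (x j) r) = ∅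

/-- The lexicographic order on `ℝ^d`: the first coordinate is compared first. -/
def LexLE {d : ℕ} (x y : EuclideanSpace ℝ (Fin d)) : Prop :=
  toLex (fun i => x i) ≤ toLex (fun i => y i)

/-- The left-most (lexicographically first) of the points `x j`, `j ∈ s`, lies in `A`. -/
def LeftMostIn {d : ℕ} {ι : Type*} (A : Set (EuclideanSpace ℝ (Fin d))) (s : Finset ι)
    (x : ι → EuclideanSpace ℝ (Fin d)) : Prop :=
  ∃ j ∈ s, x j ∈ A ∧ ∀ i ∈ s, LexLE (x j) (x i)

/-- No edge of the Čech complex of radius `r` on the points `x j`, `j ∈ t`, joins a point with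
index in `s` to a point with index in `t` outside `s`; two points are joined by an edge if they
are at distance at most `2 r`. -/
def IsIsolated {d : ℕ} {ι : Type*} (r : ℝ) (s t : Finset ι)
    (x : ι → EuclideanSpace ℝ (Fin d)) : Prop :=
  ∀ i ∈ s, ∀ j ∈ t, j ∉ s → ¬ dist (x i) (x j) ≤ 2 * r

open scoped Classical in
/-- The number of isolated empty `(k - 1)`-simplices with respect to `r`, with left-most point in
`A`, formed from the first `m` points `x 0, …, x (m - 1)` of the sequence `x`. -/
def isolatedCount {d : ℕ} (k : ℕ) (r : ℝ) (A : Set (EuclideanSpace ℝ (Fin d)))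
    (x : ℕ → EuclideanSpace ℝ (Fin d)) (m : ℕ) : ℕ :=
  (((Finset.range m).powersetCard k).filter fun s =>
    IsEmptySimplex r s x ∧ IsIsolated r s (Finset.range m) x ∧ LeftMostIn A s x).card

/-- The constant
`μ_A = (∫_A f(x)^k dx) * ∫_{(ℝ^d)^(k-1)} h₁(0, y₂, …, y_k) d(y₂, …, y_k)`,
where `h₁` is the indicator of forming an empty `(k - 1)`-simplex with respect to `1`. -/
def muA {d : ℕ} (k : ℕ) (f : EuclideanSpace ℝ (Fin d) → ℝ)
    (A : Set (EuclideanSpace ℝ (Fin d))) : ℝ :=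
  (∫ x in A, f x ^ k) *
    ∫ y : Fin (k - 1) → EuclideanSpace ℝ (Fin d),
      Set.indicator
        {y : Fin (k - 1) → EuclideanSpace ℝ (Fin d) |
          IsEmptySimplex 1 Finset.univ
            (Fin.cons 0 y : Fin (k - 1 + 1) → EuclideanSpace ℝ (Fin d))}
        (fun _ => (1 : ℝ)) y

end RandomCech

end

/-! Given `m` points, all `k`-subsets are good (empty simplex, left-most point in `A`, isolated)
with the same probability, the integral over `simplexSet` of `ν(V y)ᶜ ^ (m - k)`, where `V y` is the
`2r`-neighbourhood of the configuration `y` and `ν` is the law with density `f`. Averaging `m.choose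
k` times this over a Poisson `m` turns the power into an exponential (`lintegral_poisson_avoiding`),
so `k! E[S] = n^k ∫ exp(-n ν(V y))`. As `f` is bounded, `n ν(V y)` is at most a constant times `n
r^d → 0`, and the exponential is negligible. What remains is the probability that `k` points form
such a simplex. Putting one vertex at `x` and the others at `x + r z` extracts `r^(d(k-1))` and
leaves a quantity tending to `μ_A` (`tendsto_pi_simplexSet`).

For the variance, any two points of an empty simplex with at least three vertices are within `2r`,
so two isolated ones that share a point coincide. Hence `S² = S + D`, with `D` the number of ordered
pairs of disjoint good subsets (`isolatedCount_sq`), and `Var S - E S = E D - (E S)²`. By the same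
Poisson computation this is `n^(2k) / k!²` times the difference between a pair integral and the
square of the mean integral. The integrands agree unless the two configurations are close, so this
difference is `O(r^(d(k-1)) (r^d)^k)` (`abs_pair_sub_sq_le`). After normalisation the error is `O((n
r^d)^k)`, so mean and variance have the same limit. -/

namespace RandomCech

/-! ### Geometry and measurability of empty simplices. -/

section Geometry

variable {d : ℕ} {ι κ : Type*}

local notation "E" => EuclideanSpace ℝ (Fin d)

lemma nonempty_iInter_closedBall_iff {r : ℝ} {s : Finset ι} {x : ι → E} :
    (⋂ j ∈ s, Metric.closedBall (x j) r).Nonempty ↔ ∃ p, ∀ j ∈ s, dist p (x j) ≤ r := by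
  simp [Set.Nonempty]

lemma isEmptySimplex_iff [DecidableEq ι] {r : ℝ} {s : Finset ι} {x : ι → E} :
    IsEmptySimplex r s x ↔
      (∀ j₀ ∈ s, ∃ p, ∀ j ∈ s, j ≠ j₀ → dist p (x j) ≤ r) ∧ ¬ ∃ p, ∀ j ∈ s, dist p (x j) ≤ r := by
  rw [IsEmptySimplex, ← Set.not_nonempty_iff_eq_empty]
  simp only [nonempty_iInter_closedBall_iff, Finset.mem_erase]
  refine and_congr_left fun _ => forall₂_congr fun j₀ _ => exists_congr fun p => ?_
  simp only [Set.mem_iInter, Metric.mem_closedBall, and_imp]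
  exact forall_congr' fun j => ⟨fun h a b => h b a, fun h a b => h b a⟩

lemma isEmptySimplex_image [DecidableEq ι] [DecidableEq κ] {r : ℝ} {s : Finset ι} {x : ι → E} [Fintype κ] {e : κ → ι}
    (he : Function.Injective e) (hs : Finset.univ.image e = s) :
    IsEmptySimplex r s x ↔ IsEmptySimplex r Finset.univ (fun i => x (e i)) := by
  subst hs
  simp [isEmptySimplex_iff, he.eq_iff]

lemma leftMostIn_image [DecidableEq ι] {A : Set E} {s : Finset ι} {x : ι → E} [Fintype κ] {e : κ → ι}
    (hs : Finset.univ.image e = s) :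
    LeftMostIn A s x ↔ LeftMostIn A Finset.univ (fun i => x (e i)) := by
  subst hs
  simp [LeftMostIn]

/-- With a third vertex available to leave out, the remaining balls, among them those about `x i`
and `x j`, share a point. This is where at least three vertices are needed. -/
lemma IsEmptySimplex.dist_le [DecidableEq ι] {r : ℝ} {s : Finset ι} {x : ι → E} (h : IsEmptySimplex r s x)
    (hs : 3 ≤ s.card) {i j : ι} (hi : i ∈ s) (hj : j ∈ s) : dist (x i) (x j) ≤ 2 * r := by
  obtain ⟨l, hl, hli, hlj⟩ : ∃ l ∈ s, l ≠ i ∧ l ≠ j := by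
    have hc : ({i, j} : Finset ι).card < s.card := (Finset.card_le_two).trans_lt hs
    obtain ⟨l, hl, hl'⟩ := Finset.exists_mem_notMem_of_card_lt_card hc
    simp only [Finset.mem_insert, Finset.mem_singleton, not_or] at hl'
    exact ⟨l, hl, hl'⟩
  obtain ⟨p, hp⟩ := (isEmptySimplex_iff.1 h).1 l hl
  have h1 := hp i hi hli.symm
  have h2 := hp j hj hlj.symm
  have := dist_triangle_left (x i) (x j) p
  linarith

/-- The similarity `p ↦ a + r • p` carries common points of unit balls to common points of
`r`-balls, and back. -/
lemma isEmptySimplex_add_smul [DecidableEq ι] {r : ℝ} (hr : 0 < r) {s : Finset ι} (a : E) (x : ι → E) :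
    IsEmptySimplex r s (fun i => a + r • x i) ↔ IsEmptySimplex 1 s x := by
  have key : ∀ q : ι → Prop, (∃ p, ∀ j, q j → dist p (a + r • x j) ≤ r) ↔
      ∃ p, ∀ j, q j → dist p (x j) ≤ 1 := by
    have hd : ∀ p j, dist (a + r • p) (a + r • x j) = r * dist p (x j) := by
      intro p j
      rw [dist_add_left, dist_smul₀, Real.norm_of_nonneg hr.le]
    intro q
    constructor
    · rintro ⟨p, hp⟩
      refine ⟨r⁻¹ • (p - a), fun j hj => ?_⟩
      have h := hp j hj
      have h2 := hd (r⁻¹ • (p - a)) j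
      rw [smul_inv_smul₀ hr.ne', add_sub_cancel] at h2
      rw [h2] at h
      nlinarith
    · rintro ⟨p, hp⟩
      refine ⟨a + r • p, fun j hj => ?_⟩
      rw [hd]
      nlinarith [hp j hj]
  rw [isEmptySimplex_iff, isEmptySimplex_iff, key]
  refine and_congr_left fun _ => forall₂_congr fun j₀ _ => ?_
  simpa only [and_imp] using key (fun j => j ∈ s ∧ j ≠ j₀)

/-- The set is the sum of a compact set (a product of `r`-balls about `0`) and a closed one (the
diagonal subspace). This gives measurability in spite of the uncountable quantifier over `p`. -/
lemma isClosed_setOf_exists_forall_dist_le [Finite ι] (r : ℝ) :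
    IsClosed {x : ι → E | ∃ p, ∀ j, dist p (x j) ≤ r} := by
  have h1 : IsCompact (Set.univ.pi fun _ : ι => Metric.closedBall (0 : E) r) :=
    isCompact_univ_pi fun _ => isCompact_closedBall _ _
  have h2 : IsClosed (Set.range fun (p : E) (_ : ι) => p) := by
    have := (LinearMap.range (LinearMap.pi fun _ : ι => (LinearMap.id : E →ₗ[ℝ] E))).closed_of_finiteDimensional
    convert! this
  convert! h2.add_left_of_isCompact h1 using 1
  ext x
  simp only [Set.mem_ofPred_eq, Set.mem_add, Set.mem_pi, Set.mem_univ, true_imp_iff,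
    mem_closedBall_zero_iff, Set.mem_range, exists_exists_eq_and]
  constructor
  · rintro ⟨p, hp⟩
    refine ⟨fun i => x i - p, fun i => ?_, p, ?_⟩
    · rw [← dist_eq_norm, dist_comm]
      exact hp i
    · ext i
      simp
  · rintro ⟨y, hy, p, rfl⟩
    refine ⟨p, fun j => ?_⟩
    simpa [dist_eq_norm] using hy j

lemma measurableSet_exists_forall_dist_le [Countable ι] (r : ℝ) (s : Set ι) (hs : s.Finite) :
    MeasurableSet {x : ι → E | ∃ p, ∀ j ∈ s, dist p (x j) ≤ r} := by
  have := hs.to_subtype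
  have h := (isClosed_setOf_exists_forall_dist_le (d := d) (ι := s) r).preimage
    (f := fun x : ι → E => fun j : s => x j) (by fun_prop)
  convert! h.measurableSet using 1
  ext x
  simp

lemma measurableSet_isEmptySimplex [DecidableEq ι] [Countable ι] (r : ℝ) (s : Finset ι) :
    MeasurableSet {x : ι → E | IsEmptySimplex r s x} := by
  simp only [isEmptySimplex_iff, ← and_imp]
  refine MeasurableSet.inter ?_ ?_
  · have : {x : ι → E | ∀ j₀ ∈ s, ∃ p, ∀ j, (j ∈ s ∧ j ≠ j₀) → dist p (x j) ≤ r} =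
      ⋂ j₀ ∈ s, {x : ι → E | ∃ p, ∀ j ∈ {j | j ∈ s ∧ j ≠ j₀}, dist p (x j) ≤ r} := by
      ext; simp
    refine (this ▸ ?_ : MeasurableSet {x : ι → E | ∀ j₀ ∈ s, ∃ p, ∀ j, (j ∈ s ∧ j ≠ j₀) → dist p (x j) ≤ r})
    refine Finset.measurableSet_biInter _ fun j₀ _ => ?_
    exact measurableSet_exists_forall_dist_le r _ (s.finite_toSet.subset fun j hj => hj.1)
  · exact (measurableSet_exists_forall_dist_le r (s : Set ι) s.finite_toSet).compl

lemma measurableSet_lexLE : MeasurableSet {p : E × E | LexLE p.1 p.2} := by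
  -- Strict lexicographic order is a finite union over the first coordinate at which the points
  -- differ.
  have : {p : E × E | LexLE p.1 p.2} = {p | p.1 = p.2} ∪
      ⋃ i : Fin d, ((⋂ j : Fin d, {p : E × E | j < i → p.1 j = p.2 j}) ∩ {p | p.1 i < p.2 i}) := by
    ext p
    simp only [LexLE, le_iff_lt_or_eq, Set.mem_ofPred_eq, Set.mem_union, Set.mem_iUnion,
      Set.mem_inter_iff, Set.mem_iInter, toLex_inj]
    rw [or_comm]
    refine or_congr ?_ Iff.rfl
    constructor
    · intro h; ext i; exact congrFun h i
    · intro h; rw [h]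
  rw [this]
  refine MeasurableSet.union (measurableSet_eq_fun measurable_fst measurable_snd) ?_
  refine MeasurableSet.iUnion fun i => MeasurableSet.inter (MeasurableSet.iInter fun j => ?_) ?_
  · by_cases h : j < i
    · simp only [h, true_imp_iff]
      exact measurableSet_eq_fun (by fun_prop) (by fun_prop)
    · simp [h]
  · exact measurableSet_lt (by fun_prop) (by fun_prop)

lemma measurableSet_leftMostIn {A : Set E} (hA : MeasurableSet A) (s : Finset ι) :
    MeasurableSet {x : ι → E | LeftMostIn A s x} := by
  have : {x : ι → E | LeftMostIn A s x} =
      ⋃ j ∈ s, ({x | x j ∈ A} ∩ ⋂ i ∈ s, {x | LexLE (x j) (x i)}) := by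
    ext; simp [LeftMostIn, and_left_comm]
  rw [this]
  refine Finset.measurableSet_biUnion _ fun j _ => MeasurableSet.inter (measurable_pi_apply j hA) ?_
  refine Finset.measurableSet_biInter _ fun i _ => ?_
  exact measurableSet_lexLE.preimage (f := fun x : ι → E => (x j, x i)) ((measurable_pi_apply j).prodMk (measurable_pi_apply i))

lemma leftMostIn_of_forall_mem {A : Set E} {s : Finset ι} (hs : s.Nonempty) {x : ι → E}
    (h : ∀ i ∈ s, x i ∈ A) : LeftMostIn A s x := by
  obtain ⟨j, hj, hmin⟩ := s.exists_min_image (fun j => toLex (fun i => x j i)) hs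
  exact ⟨j, hj, h j hj, hmin⟩

/-- The points of `ℝ^d` at distance at most `2 r` from one of the points `y i`. -/
def nearby (r : ℝ) (y : ι → E) : Set E := ⋃ i, Metric.closedBall (y i) (2 * r)

lemma mem_nearby {r : ℝ} {y : ι → E} {z : E} : z ∈ nearby r y ↔ ∃ i, dist (y i) z ≤ 2 * r := by
  simp [nearby, dist_comm]

lemma measurableSet_nearby [Countable ι] (r : ℝ) (y : ι → E) : MeasurableSet (nearby r y) :=
  MeasurableSet.iUnion fun _ => Metric.isClosed_closedBall.measurableSet

lemma measurableSet_mem_nearby [Countable ι] (r : ℝ) :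
    MeasurableSet {p : (ι → E) × E | p.2 ∈ nearby r p.1} := by
  have : {p : (ι → E) × E | p.2 ∈ nearby r p.1} =
      ⋃ i, {p : (ι → E) × E | dist (p.1 i) p.2 ≤ 2 * r} := by
    ext; simp [mem_nearby]
  rw [this]
  exact MeasurableSet.iUnion fun i => measurableSet_le (by fun_prop) (by fun_prop)

lemma isIsolated_image [DecidableEq ι] {r : ℝ} {s t : Finset ι} {x : ι → E} [Fintype κ] {e : κ → ι}
    (hs : Finset.univ.image e = s) :
    IsIsolated r s t x ↔ ∀ j ∈ t, j ∉ s → x j ∉ nearby r (fun i => x (e i)) := by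
  subst hs
  simp only [IsIsolated, mem_nearby]
  simp
  tauto

/-- The configurations which form an empty simplex with respect to `r` and whose left-most point
lies in `A`. -/
def simplexSet (ι : Type*) [DecidableEq ι] [Fintype ι] (r : ℝ) (A : Set E) : Set (ι → E) :=
  {y | IsEmptySimplex r Finset.univ y ∧ LeftMostIn A Finset.univ y}

lemma measurableSet_simplexSet [DecidableEq ι] [Fintype ι] (r : ℝ) {A : Set E} (hA : MeasurableSet A) :
    MeasurableSet (simplexSet ι r A) :=
  (measurableSet_isEmptySimplex r _).inter (measurableSet_leftMostIn hA _)

end Geometry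

/-! ### Averaging over a Poisson number of independent points. -/

section Poissonization

open scoped ENNReal NNReal

/-- The terms with `m < l` vanish. After the shift `m ↦ m + l` the falling factorial cancels against
`(m + l)!`, leaving the exponential series of `n p`. -/
lemma hasSum_poisson_descFactorial_mul_pow (n p : ℝ) (l : ℕ) :
    HasSum (fun m : ℕ => Real.exp (-n) * n ^ m / m.factorial *
      ((m.descFactorial l : ℝ) * p ^ (m - l))) (n ^ l * Real.exp (-n * (1 - p))) := by
  rw [← (add_left_injective l).hasSum_iff]
  · have h := ((NormedSpace.expSeries_div_hasSum_exp (n * p)).mul_left (n ^ l * Real.exp (-n)))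
    rw [← Real.exp_eq_exp_ℝ, mul_assoc, ← Real.exp_add] at h
    convert! h using 1
    · ext m
      have h1 := Nat.factorial_mul_descFactorial (Nat.le_add_left l m)
      rw [Nat.add_sub_cancel] at h1
      have h2 : ((m + l).factorial : ℝ) = m.factorial * (m + l).descFactorial l := by
        exact_mod_cast h1.symm
      have h3 : (m.factorial : ℝ) ≠ 0 := by positivity
      have h4 : ((m + l).descFactorial l : ℝ) ≠ 0 := by
        intro h0
        rw [h0, mul_zero] at h2
        exact (Nat.cast_ne_zero.2 (Nat.factorial_ne_zero _)) h2
      simp only [Function.comp_apply, Nat.add_sub_cancel, h2]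
      field_simp
      ring
    · congr 2
      ring
  · intro m hm
    have : m < l := by
      by_contra h
      exact hm ⟨m - l, Nat.sub_add_cancel (not_lt.1 h)⟩
    simp [Nat.descFactorial_of_lt this]

lemma tsum_poissonMeasure_descFactorial_mul_pow (n : ℝ≥0) {p : ℝ} (hp : 0 ≤ p) (l : ℕ) :
    ∑' m : ℕ, poissonMeasure n {m} * ((m.descFactorial l : ℝ≥0∞) * ENNReal.ofReal p ^ (m - l)) =
      ENNReal.ofReal (n ^ l * Real.exp (-n * (1 - p))) := by
  have h := hasSum_poisson_descFactorial_mul_pow n p l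
  rw [← h.tsum_eq, ENNReal.ofReal_tsum_of_nonneg (fun m => by positivity) h.summable]
  refine tsum_congr fun m => ?_
  rw [poissonMeasure_singleton, ENNReal.ofReal_mul (by positivity),
    ENNReal.ofReal_mul (Nat.cast_nonneg _), ENNReal.ofReal_natCast, ENNReal.ofReal_pow hp]

variable {α Ω : Type*} [MeasurableSpace α] [MeasurableSpace Ω] {P : Measure Ω}
  [IsProbabilityMeasure P] {X : ℕ → Ω → α} {ν : Measure α}

lemma map_comp_eq_pi (hX_meas : ∀ i, Measurable (X i)) (hX_indep : iIndepFun X P)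
    (hX_law : ∀ i, P.map (X i) = ν) {I : Type*} [Fintype I] {e : I → ℕ}
    (he : Function.Injective e) :
    P.map (fun ω i => X (e i) ω) = Measure.pi fun _ : I => ν := by
  have h := hX_indep.precomp he
  rw [iIndepFun_iff_map_fun_eq_pi_map fun i => (hX_meas _).aemeasurable] at h
  simpa only [hX_law] using h

variable [IsProbabilityMeasure ν]

/-- The probability that the points with indices `e i` have a given property `B` while all the
other points with indices in `t` avoid a set `V` determined by the former. -/
lemma measure_avoiding (hX_meas : ∀ i, Measurable (X i)) (hX_indep : iIndepFun X P)
    (hX_law : ∀ i, P.map (X i) = ν) {I : Type*} [Fintype I] {e : I → ℕ}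
    (he : Function.Injective e) {t : Finset ℕ} (ht : ∀ i, e i ∈ t) {B : Set (I → α)}
    (hB : MeasurableSet B) {V : (I → α) → Set α}
    (hV : MeasurableSet {p : (I → α) × α | p.2 ∈ V p.1}) :
    P {ω | (fun i => X (e i) ω) ∈ B ∧
        ∀ j ∈ t, j ∉ Finset.univ.image e → X j ω ∉ V fun i => X (e i) ω} =
      ∫⁻ y in B, ν (V y)ᶜ ^ (t.card - Fintype.card I) ∂Measure.pi fun _ : I => ν := by
  classical
  set C := t \ Finset.univ.image e with hC
  have hCcard : Fintype.card C = t.card - Fintype.card I := by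
    rw [Fintype.card_coe, hC, Finset.card_sdiff_of_subset, Finset.card_image_of_injective _ he,
      Finset.card_univ]
    intro j hj
    obtain ⟨i, -, rfl⟩ := Finset.mem_image.1 hj
    exact ht i
  -- Gluing `e` to the inclusion of the remaining indices gives one injective family, whose joint
  -- law is a product. Fubini then integrates out the points in `C` for a fixed configuration `y`.
  set g : I ⊕ C → ℕ := Sum.elim e (fun j => j) with hg_def
  have hg : Function.Injective g := by
    refine he.sumElim Subtype.val_injective fun i j h => ?_
    have := (Finset.mem_sdiff.1 j.2).2
    exact this (h ▸ Finset.mem_image_of_mem e (Finset.mem_univ i))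
  set S : Set ((I → α) × (C → α)) := {p | p.1 ∈ B ∧ ∀ j, p.2 j ∉ V p.1} with hS_def
  have hS : MeasurableSet S := by
    have : S = Prod.fst ⁻¹' B ∩ ⋂ j, (fun p : (I → α) × (C → α) => (p.1, p.2 j)) ⁻¹'
        {p : (I → α) × α | p.2 ∈ V p.1}ᶜ := by
      ext; simp [hS_def]
    rw [this]
    exact (measurable_fst hB).inter (MeasurableSet.iInter fun j =>
      hV.compl.preimage (by fun_prop))
  have hmp := measurePreserving_sumPiEquivProdPi (fun _ : I ⊕ C => ν)
  have hmap := map_comp_eq_pi hX_meas hX_indep hX_law hg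
  have hset : {ω | (fun i => X (e i) ω) ∈ B ∧
      ∀ j ∈ t, j ∉ Finset.univ.image e → X j ω ∉ V fun i => X (e i) ω} =
      (fun ω i => X (g i) ω) ⁻¹' ((MeasurableEquiv.sumPiEquivProdPi fun _ : I ⊕ C => α) ⁻¹' S) := by
    ext ω
    refine and_congr Iff.rfl ?_
    exact ⟨fun h j => h j (Finset.mem_sdiff.1 j.2).1 (Finset.mem_sdiff.1 j.2).2,
      fun h j h1 h2 => h ⟨j, Finset.mem_sdiff.2 ⟨h1, h2⟩⟩⟩
  rw [hset, ← Measure.map_apply (by fun_prop) (hmp.measurable hS), hmap,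
    hmp.measure_preimage hS.nullMeasurableSet, Measure.prod_apply hS, ← lintegral_indicator hB]
  refine lintegral_congr fun y => ?_
  by_cases hy : y ∈ B
  · rw [Set.indicator_of_mem hy]
    have : Prod.mk y ⁻¹' S = Set.univ.pi fun _ : C => (V y)ᶜ := by
      ext z; simp [hS_def, hy]
    rw [this, Measure.pi_pi, Finset.prod_const, Finset.card_univ, hCcard]
  · rw [Set.indicator_of_notMem hy]
    have : Prod.mk y ⁻¹' S = ∅ := by
      ext z; simp [hS_def, hy]
    rw [this, measure_empty]

lemma lintegral_poisson_indep {N : Ω → ℕ} (hX_meas : ∀ i, Measurable (X i))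
    (hN_meas : Measurable N) {n : ℝ≥0}
    (hN_law : P.map N = poissonMeasure n) (hN_indep : IndepFun N (fun ω i => X i ω) P)
    {G : ℕ → (ℕ → α) → ℝ≥0∞} (hG : ∀ m, Measurable (G m)) :
    ∫⁻ ω, G (N ω) (fun i => X i ω) ∂P =
      ∑' m, poissonMeasure n {m} * ∫⁻ ω, G m (fun i => X i ω) ∂P := by
  have hX : Measurable fun ω i => X i ω := by fun_prop
  have hGm : Measurable (Function.uncurry G) := measurable_from_prod_countable_right hG
  have h1 := (indepFun_iff_map_prod_eq_prod_map_map hN_meas.aemeasurable hX.aemeasurable).1 hN_indep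
  have h2 : IsProbabilityMeasure (P.map fun ω i => X i ω) :=
    Measure.isProbabilityMeasure_map hX.aemeasurable
  calc ∫⁻ ω, G (N ω) (fun i => X i ω) ∂P
      = ∫⁻ q, Function.uncurry G q ∂(P.map fun ω => (N ω, fun i => X i ω)) := by
        rw [lintegral_map hGm (hN_meas.prodMk hX)]
        rfl
    _ = ∑' m, poissonMeasure n {m} * ∫⁻ ω, G m (fun i => X i ω) ∂P := by
        rw [h1, lintegral_prod _ hGm.aemeasurable, lintegral_countable', hN_law]
        refine tsum_congr fun m => ?_
        rw [mul_comm, ← lintegral_map (hG m) hX]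
        rfl

/-- Poissonization of a count whose mean given `m` points is a multiple of the `m`-th falling
factorial. -/
lemma lintegral_poisson_avoiding {N : Ω → ℕ} (hX_meas : ∀ i, Measurable (X i))
    (hN_meas : Measurable N) {n : ℝ≥0}
    (hN_law : P.map N = poissonMeasure n) (hN_indep : IndepFun N (fun ω i => X i ω) P)
    {G : ℕ → (ℕ → α) → ℝ≥0∞} (hG : ∀ m, Measurable (G m))
    {I : Type*} [Fintype I] {B : Set (I → α)} {V : (I → α) → Set α}
    (hV : MeasurableSet {p : (I → α) × α | p.2 ∈ V p.1}) {c : ℕ → ℝ≥0∞} {K : ℝ≥0∞}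
    (hK : ∀ m, K * c m = (m.descFactorial (Fintype.card I) : ℝ≥0∞))
    (hGc : ∀ m, ∫⁻ ω, G m (fun i => X i ω) ∂P =
      c m * ∫⁻ y in B, ν (V y)ᶜ ^ (m - Fintype.card I) ∂Measure.pi fun _ : I => ν) :
    K * ∫⁻ ω, G (N ω) (fun i => X i ω) ∂P =
      ∫⁻ y in B, ENNReal.ofReal (n ^ Fintype.card I * Real.exp (-n * ν.real (V y)))
        ∂Measure.pi fun _ : I => ν := by
  have hVm : ∀ y, MeasurableSet (V y) := fun y => hV.preimage (f := fun z => (y, z)) (by fun_prop)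
  have hνV : Measurable fun y => ν (V y)ᶜ := measurable_measure_prodMk_left hV.compl
  have hpow : ∀ j, Measurable fun y => ν (V y)ᶜ ^ j := fun j => hνV.pow_const j
  rw [lintegral_poisson_indep hX_meas hN_meas hN_law hN_indep hG, ← ENNReal.tsum_mul_left]
  have h1 : ∀ m, K * (poissonMeasure n {m} * ∫⁻ ω, G m (fun i => X i ω) ∂P) =
      ∫⁻ y in B, poissonMeasure n {m} * ((m.descFactorial (Fintype.card I) : ℝ≥0∞) *
        ν (V y)ᶜ ^ (m - Fintype.card I)) ∂Measure.pi fun _ : I => ν := by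
    intro m
    rw [hGc, lintegral_const_mul _ ((hpow _).const_mul _), lintegral_const_mul _ (hpow _), ← hK]
    ring
  simp_rw [h1]
  -- By Tonelli the Poisson series is summed for fixed `y`, with `p = ν(V y)ᶜ` and so `1 - p = ν(V
  -- y)`.
  rw [← lintegral_tsum fun m => (((hpow _).const_mul _).const_mul _).aemeasurable]
  refine lintegral_congr fun y => ?_
  have h2 : ν (V y)ᶜ = ENNReal.ofReal (ν.real (V y)ᶜ) := by simp
  rw [h2, tsum_poissonMeasure_descFactorial_mul_pow _ measureReal_nonneg,
    probReal_compl_eq_one_sub (hVm y), sub_sub_cancel]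

end Poissonization

/-! ### Expected numbers of isolated simplices and of disjoint pairs of them. -/

section Counts

open scoped ENNReal NNReal

variable {d : ℕ}

local notation "E" => EuclideanSpace ℝ (Fin d)

/-- The points with index in `s` form an empty simplex with left-most point in `A`, isolated from
the other points with index in `t`. -/
def IsGood (r : ℝ) (A : Set E) (s t : Finset ℕ) (x : ℕ → E) : Prop :=
  IsEmptySimplex r s x ∧ IsIsolated r s t x ∧ LeftMostIn A s x

/-- Puts goodness into the form required by `measure_avoiding`: a condition on the chosen points,
and avoidance of their neighbourhood by all others. -/
lemma isGood_image {κ : Type*} [DecidableEq κ] [Fintype κ] {e : κ → ℕ}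
    (he : Function.Injective e) {s : Finset ℕ} (hs : Finset.univ.image e = s) {r : ℝ} {A : Set E}
    {t : Finset ℕ} {x : ℕ → E} :
    IsGood r A s t x ↔ (fun i => x (e i)) ∈ simplexSet κ r A ∧
      ∀ j ∈ t, j ∉ Finset.univ.image e → x j ∉ nearby r fun i => x (e i) := by
  rw [IsGood, isEmptySimplex_image he hs, leftMostIn_image hs, isIsolated_image hs, hs, simplexSet,
    Set.mem_ofPred_eq]
  tauto

lemma measurableSet_isGood {A : Set E} (hA : MeasurableSet A) (r : ℝ) (s t : Finset ℕ) :
    MeasurableSet {x : ℕ → E | IsGood r A s t x} := by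
  refine (measurableSet_isEmptySimplex r s).inter (MeasurableSet.inter ?_
    (measurableSet_leftMostIn hA s))
  have : {x : ℕ → E | IsIsolated r s t x} =
      ⋂ i ∈ s, ⋂ j ∈ t, {x | j ∉ s → ¬ dist (x i) (x j) ≤ 2 * r} := by
    ext; simp [IsIsolated]
  change MeasurableSet {x : ℕ → E | IsIsolated r s t x}
  rw [this]
  refine Finset.measurableSet_biInter _ fun i _ => Finset.measurableSet_biInter _ fun j _ => ?_
  by_cases h : j ∈ s
  · simp [h]
  · simp only [h, not_false_eq_true, true_imp_iff]
    exact (measurableSet_le ((measurable_pi_apply i).dist (measurable_pi_apply j))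
      measurable_const).compl

open scoped Classical in
/-- The number of ordered pairs of disjoint isolated empty simplices. -/
noncomputable def disjointPairCount (k : ℕ) (r : ℝ) (A : Set E) (x : ℕ → E) (m : ℕ) : ℕ :=
  ∑ s ∈ (Finset.range m).powersetCard k, ∑ t ∈ (Finset.range m \ s).powersetCard k,
    if IsGood r A s (Finset.range m) x ∧ IsGood r A t (Finset.range m) x then 1 else 0

/-- A point of `t` outside `s` would be within `2r` of a shared point, as both are vertices of `t`,
against the isolation of `s`. So `t ⊆ s`, and the cardinalities agree. -/
lemma IsGood.eq_of_not_disjoint {r : ℝ} {A : Set E} {s t u : Finset ℕ} {x : ℕ → E}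
    (hs : IsGood r A s u x) (ht : IsGood r A t u x) (hcard : s.card = t.card)
    (htu : t ⊆ u) (h3 : 3 ≤ t.card) (h : ¬ Disjoint s t) : s = t := by
  obtain ⟨i, his, hit⟩ := Finset.not_disjoint_iff.1 h
  refine (Finset.eq_of_subset_of_card_le (fun j hj => ?_) hcard.le).symm
  by_contra hjs
  exact hs.2.1 i his j (htu hj) hjs (ht.1.dist_le h3 hit hj)

/-- For a fixed good `s`, the good `t` are `s` itself and those disjoint from `s`; the diagonal
contributes the linear term. -/
lemma isolatedCount_sq {k : ℕ} (hk : 3 ≤ k) (r : ℝ) (A : Set E) (x : ℕ → E) (m : ℕ) :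
    isolatedCount k r A x m ^ 2 = isolatedCount k r A x m + disjointPairCount k r A x m := by
  classical
  have hcount : isolatedCount k r A x m =
      ∑ s ∈ (Finset.range m).powersetCard k, if IsGood r A s (Finset.range m) x then 1 else 0 := by
    rw [isolatedCount, Finset.card_filter]
    exact Finset.sum_congr rfl fun s _ => by congr
  rw [sq]
  nth_rewrite 1 [hcount]
  nth_rewrite 2 [hcount]
  rw [disjointPairCount, ← Finset.sum_add_distrib, Finset.sum_mul]
  refine Finset.sum_congr rfl fun s hs => ?_
  by_cases hg : IsGood r A s (Finset.range m) x
  · simp only [hg, if_true, one_mul, true_and]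
    rw [isolatedCount, ← Finset.card_filter, add_comm, ← Finset.card_insert_of_notMem (a := s)]
    · congr 1
      ext t
      simp only [Finset.mem_filter, Finset.mem_insert, Finset.mem_powersetCard] at hs ⊢
      constructor
      · rintro ⟨⟨ht, htk⟩, hgt⟩
        by_cases hd : Disjoint s t
        · exact Or.inr ⟨⟨Finset.subset_sdiff.2 ⟨ht, hd.symm⟩, htk⟩, hgt⟩
        · exact Or.inl (hg.eq_of_not_disjoint hgt (hs.2.trans htk.symm) ht (htk ▸ hk) hd).symm
      · rintro (rfl | ⟨⟨ht, htk⟩, hgt⟩)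
        · exact ⟨hs, hg⟩
        · exact ⟨⟨ht.trans Finset.sdiff_subset, htk⟩, hgt⟩
    · intro h
      have h1 := (Finset.mem_powersetCard.1 (Finset.mem_filter.1 h).1)
      have h2 : Disjoint s s := (Finset.subset_sdiff.1 h1.1).2
      rw [disjoint_self, Finset.bot_eq_empty] at h2
      rw [h2, Finset.card_empty] at h1
      omega
  · simp [hg]

/-- The pairs of configurations in `simplexSet` none of whose mutual distances is at most `2 r`. -/
def simplexPairSet (k : ℕ) (r : ℝ) (A : Set E) : Set (Fin k ⊕ Fin k → E) :=
  {w | (fun i => w (.inl i)) ∈ simplexSet (Fin k) r A ∧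
    (fun i => w (.inr i)) ∈ simplexSet (Fin k) r A ∧
    ∀ i j, ¬ dist (w (.inl i)) (w (.inr j)) ≤ 2 * r}

lemma measurableSet_simplexPairSet (k : ℕ) (r : ℝ) {A : Set E} (hA : MeasurableSet A) :
    MeasurableSet (simplexPairSet k r A) := by
  have h := measurableSet_simplexSet (ι := Fin k) r hA
  refine (h.preimage (f := fun w : Fin k ⊕ Fin k → E => fun i => w (.inl i)) (by fun_prop)).inter
    ((h.preimage (f := fun w : Fin k ⊕ Fin k → E => fun i => w (.inr i)) (by fun_prop)).inter ?_)
  have : {w : Fin k ⊕ Fin k → E | ∀ i j, ¬ dist (w (.inl i)) (w (.inr j)) ≤ 2 * r} =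
      ⋂ i, ⋂ j, {w : Fin k ⊕ Fin k → E | dist (w (.inl i)) (w (.inr j)) ≤ 2 * r}ᶜ := by
    ext; simp
  change MeasurableSet {w : Fin k ⊕ Fin k → E | ∀ i j, ¬ dist (w (.inl i)) (w (.inr j)) ≤ 2 * r}
  rw [this]
  exact MeasurableSet.iInter fun i => MeasurableSet.iInter fun j =>
    (measurableSet_le (by fun_prop) (by fun_prop)).compl

/-- Mutual isolation of `s` and `t` is a condition on the `2k` points alone, contained in
`simplexPairSet`. All other points must avoid the neighbourhood of the union. -/
lemma isGood_and_isGood_iff {k : ℕ} {es et : Fin k → ℕ} (hes : Function.Injective es)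
    (het : Function.Injective et) {s t u : Finset ℕ} (hs : Finset.univ.image es = s)
    (ht : Finset.univ.image et = t) (htu : t ⊆ u) (hd : Disjoint s t) {r : ℝ}
    {A : Set E} {x : ℕ → E} :
    IsGood r A s u x ∧ IsGood r A t u x ↔
      (fun i => x (Sum.elim es et i)) ∈ simplexPairSet k r A ∧
      ∀ j ∈ u, j ∉ Finset.univ.image (Sum.elim es et) →
        x j ∉ nearby r fun i => x (Sum.elim es et i) := by
  have hmem : ∀ j, j ∈ Finset.univ.image (Sum.elim es et) ↔ j ∈ s ∨ j ∈ t := by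
    intro j
    simp [← hs, ← ht]
  have hmems : ∀ i, es i ∈ s := fun i => hs ▸ Finset.mem_image_of_mem _ (Finset.mem_univ i)
  have hmemt : ∀ i, et i ∈ t := fun i => ht ▸ Finset.mem_image_of_mem _ (Finset.mem_univ i)
  rw [isGood_image hes hs, isGood_image het ht, hs, ht]
  simp only [hmem, simplexPairSet, Set.mem_ofPred_eq, mem_nearby, Sum.exists, Sum.elim_inl,
    Sum.elim_inr, not_or, not_exists]
  constructor
  · rintro ⟨⟨h1, h2⟩, h3, h4⟩
    refine ⟨⟨h1, h3, fun i j => ?_⟩, fun j hj hjs => ⟨h2 j hj hjs.1, h4 j hj hjs.2⟩⟩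
    exact h2 _ (htu (hmemt j)) (fun h => Finset.disjoint_left.1 hd h (hmemt j)) i
  · rintro ⟨⟨h1, h3, h5⟩, h6⟩
    refine ⟨⟨h1, fun j hj hjs i => ?_⟩, h3, fun j hj hjt i => ?_⟩
    · by_cases hjt : j ∈ t
      · obtain ⟨l, -, rfl⟩ := Finset.mem_image.1 (ht ▸ hjt)
        exact h5 i l
      · exact (h6 j hj ⟨hjs, hjt⟩).1 i
    · by_cases hjs : j ∈ s
      · obtain ⟨l, -, rfl⟩ := Finset.mem_image.1 (hs ▸ hjs)
        rw [dist_comm]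
        exact h5 l i
      · exact (h6 j hj ⟨hjs, hjt⟩).2 i

variable {Ω : Type*} [MeasurableSpace Ω] {P : Measure Ω}
  [IsProbabilityMeasure P] {X : ℕ → Ω → EuclideanSpace ℝ (Fin d)}
  {ν : Measure (EuclideanSpace ℝ (Fin d))} [IsProbabilityMeasure ν]

lemma cast_isolatedCount (k : ℕ) (r : ℝ) (A : Set E) (x : ℕ → E) (m : ℕ) :
    (isolatedCount k r A x m : ℝ≥0∞) = ∑ s ∈ (Finset.range m).powersetCard k,
      Set.indicator {x | IsGood r A s (Finset.range m) x} 1 x := by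
  classical
  rw [isolatedCount, Finset.card_filter, Nat.cast_sum]
  refine Finset.sum_congr rfl fun s _ => ?_
  simp only [Set.indicator_apply, Set.mem_ofPred_eq, IsGood, Pi.one_apply]
  split_ifs <;> simp

lemma cast_disjointPairCount (k : ℕ) (r : ℝ) (A : Set E) (x : ℕ → E) (m : ℕ) :
    (disjointPairCount k r A x m : ℝ≥0∞) = ∑ s ∈ (Finset.range m).powersetCard k,
      ∑ t ∈ (Finset.range m \ s).powersetCard k, Set.indicator
        {x | IsGood r A s (Finset.range m) x ∧ IsGood r A t (Finset.range m) x} 1 x := by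
  classical
  rw [disjointPairCount, Nat.cast_sum]
  refine Finset.sum_congr rfl fun s _ => ?_
  rw [Nat.cast_sum]
  refine Finset.sum_congr rfl fun t _ => ?_
  simp only [Set.indicator_apply, Set.mem_ofPred_eq, Pi.one_apply]
  split_ifs <;> simp

lemma measurable_cast_isolatedCount (k : ℕ) (r : ℝ) {A : Set E} (hA : MeasurableSet A) (m : ℕ) :
    Measurable fun x : ℕ → E => (isolatedCount k r A x m : ℝ≥0∞) := by
  simp only [cast_isolatedCount]
  exact Finset.measurable_fun_sum _ fun s _ =>
    measurable_one.indicator (measurableSet_isGood hA r s _)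

lemma measurable_cast_disjointPairCount (k : ℕ) (r : ℝ) {A : Set E} (hA : MeasurableSet A)
    (m : ℕ) : Measurable fun x : ℕ → E => (disjointPairCount k r A x m : ℝ≥0∞) := by
  simp only [cast_disjointPairCount]
  exact Finset.measurable_fun_sum _ fun s _ => Finset.measurable_fun_sum _ fun t _ =>
    measurable_one.indicator ((measurableSet_isGood hA r s _).inter (measurableSet_isGood hA r t _))

/-- Every `k`-subset, enumerated increasingly, has the same joint law, so linearity of expectation
gives `m.choose k` equal terms. -/
lemma lintegral_isolatedCount (hX_meas : ∀ i, Measurable (X i)) (hX_indep : iIndepFun X P)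
    (hX_law : ∀ i, P.map (X i) = ν) (k : ℕ) (r : ℝ) {A : Set E} (hA : MeasurableSet A) (m : ℕ) :
    ∫⁻ ω, (isolatedCount k r A (fun i => X i ω) m : ℝ≥0∞) ∂P =
      (m.choose k : ℝ≥0∞) * ∫⁻ y in simplexSet (Fin k) r A, ν (nearby r y)ᶜ ^ (m - k)
        ∂Measure.pi fun _ : Fin k => ν := by
  have hX : Measurable fun ω i => X i ω := by fun_prop
  simp only [cast_isolatedCount]
  have hmeas' : ∀ s : Finset ℕ, Measurable fun ω => Set.indicator
      {x : ℕ → E | IsGood r A s (Finset.range m) x} (1 : (ℕ → E) → ℝ≥0∞) (fun i => X i ω) :=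
    fun s => (measurable_one.indicator (measurableSet_isGood hA r s _)).comp hX
  rw [lintegral_finsetSum _ fun s _ => hmeas' s]
  rw [Finset.sum_congr rfl (g := fun _ => ∫⁻ y in simplexSet (Fin k) r A,
    ν (nearby r y)ᶜ ^ (m - k) ∂Measure.pi fun _ : Fin k => ν)]
  · simp
  · intro s hs
    obtain ⟨hsm, hsk⟩ := Finset.mem_powersetCard.1 hs
    have himg : Finset.univ.image (s.orderEmbOfFin hsk) = s := Finset.image_orderEmbOfFin_univ s hsk
    have h := measure_avoiding hX_meas hX_indep hX_law (s.orderEmbOfFin hsk).injective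
      (fun i => hsm (s.orderEmbOfFin_mem hsk i)) (measurableSet_simplexSet r hA)
      (measurableSet_mem_nearby r)
    rw [Finset.card_range, Fintype.card_fin] at h
    rw [← h, ← Set.ext (fun ω => isGood_image (s.orderEmbOfFin hsk).injective himg :
      ∀ ω, ω ∈ (fun ω i => X i ω) ⁻¹' {x | IsGood r A s (Finset.range m) x} ↔ _)]
    exact lintegral_indicator_one (hX (measurableSet_isGood hA r s _))

lemma lintegral_disjointPairCount (hX_meas : ∀ i, Measurable (X i)) (hX_indep : iIndepFun X P)
    (hX_law : ∀ i, P.map (X i) = ν) (k : ℕ) (r : ℝ) {A : Set E} (hA : MeasurableSet A) (m : ℕ) :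
    ∫⁻ ω, (disjointPairCount k r A (fun i => X i ω) m : ℝ≥0∞) ∂P =
      ((m.choose k * (m - k).choose k : ℕ) : ℝ≥0∞) *
        ∫⁻ w in simplexPairSet k r A, ν (nearby r w)ᶜ ^ (m - (k + k))
          ∂Measure.pi fun _ : Fin k ⊕ Fin k => ν := by
  have hX : Measurable fun ω i => X i ω := by fun_prop
  simp only [cast_disjointPairCount]
  have hmeas : ∀ s t : Finset ℕ, MeasurableSet {x : ℕ → E |
      IsGood r A s (Finset.range m) x ∧ IsGood r A t (Finset.range m) x} := fun s t =>
    (measurableSet_isGood hA r s _).inter (measurableSet_isGood hA r t _)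
  have hmeas' : ∀ s t : Finset ℕ, Measurable fun ω => Set.indicator {x : ℕ → E |
      IsGood r A s (Finset.range m) x ∧ IsGood r A t (Finset.range m) x}
      (1 : (ℕ → E) → ℝ≥0∞) (fun i => X i ω) := fun s t =>
    (measurable_one.indicator (hmeas s t)).comp hX
  rw [lintegral_finsetSum _ fun s _ => Finset.measurable_fun_sum _ fun t _ => hmeas' s t]
  rw [Finset.sum_congr rfl (g := fun _ => ((m - k).choose k : ℝ≥0∞) *
    ∫⁻ w in simplexPairSet k r A, ν (nearby r w)ᶜ ^ (m - (k + k))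
      ∂Measure.pi fun _ : Fin k ⊕ Fin k => ν)]
  · simp [mul_assoc]
  · intro s hs
    obtain ⟨hsm, hsk⟩ := Finset.mem_powersetCard.1 hs
    rw [lintegral_finsetSum _ fun t _ => hmeas' s t]
    rw [Finset.sum_congr rfl (g := fun _ => ∫⁻ w in simplexPairSet k r A,
      ν (nearby r w)ᶜ ^ (m - (k + k)) ∂Measure.pi fun _ : Fin k ⊕ Fin k => ν)]
    · simp [Finset.card_sdiff_of_subset hsm, hsk]
    · intro t ht
      obtain ⟨htm, htk⟩ := Finset.mem_powersetCard.1 ht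
      obtain ⟨htm, hdisj⟩ := Finset.subset_sdiff.1 htm
      have himgs : Finset.univ.image (s.orderEmbOfFin hsk) = s :=
        Finset.image_orderEmbOfFin_univ s hsk
      have himgt : Finset.univ.image (t.orderEmbOfFin htk) = t :=
        Finset.image_orderEmbOfFin_univ t htk
      have hinj : Function.Injective (Sum.elim (s.orderEmbOfFin hsk) (t.orderEmbOfFin htk)) := by
        refine (s.orderEmbOfFin hsk).injective.sumElim (t.orderEmbOfFin htk).injective
          fun i j hij => ?_
        exact Finset.disjoint_left.1 hdisj (hij ▸ t.orderEmbOfFin_mem htk j)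
          (s.orderEmbOfFin_mem hsk i)
      have h := measure_avoiding (t := Finset.range m) hX_meas hX_indep hX_law hinj
        (by
          rintro (i | i)
          · exact hsm (s.orderEmbOfFin_mem hsk i)
          · exact htm (t.orderEmbOfFin_mem htk i))
        (measurableSet_simplexPairSet k r hA) (measurableSet_mem_nearby r)
      rw [Finset.card_range, Fintype.card_sum, Fintype.card_fin] at h
      have hiff := fun x : ℕ → E => isGood_and_isGood_iff (s.orderEmbOfFin hsk).injective
        (t.orderEmbOfFin htk).injective himgs himgt htm hdisj.symm (r := r) (A := A) (x := x)
      rw [← h, ← Set.ext (fun ω => hiff fun i => X i ω : ∀ ω, ω ∈ (fun ω i => X i ω) ⁻¹'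
        {x | IsGood r A s (Finset.range m) x ∧ IsGood r A t (Finset.range m) x} ↔ _)]
      exact lintegral_indicator_one (hX (hmeas s t))

variable {N : Ω → ℕ} {n : ℝ≥0}

lemma lintegral_isolatedCount_poisson (hX_meas : ∀ i, Measurable (X i)) (hX_indep : iIndepFun X P)
    (hX_law : ∀ i, P.map (X i) = ν) (hN_meas : Measurable N) (hN_law : P.map N = poissonMeasure n)
    (hN_indep : IndepFun N (fun ω i => X i ω) P) (k : ℕ) (r : ℝ) {A : Set E}
    (hA : MeasurableSet A) :
    (k.factorial : ℝ≥0∞) * ∫⁻ ω, (isolatedCount k r A (fun i => X i ω) (N ω) : ℝ≥0∞) ∂P =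
      ∫⁻ y in simplexSet (Fin k) r A,
        ENNReal.ofReal (n ^ k * Real.exp (-n * ν.real (nearby r y)))
          ∂Measure.pi fun _ : Fin k => ν := by
  have h := lintegral_poisson_avoiding (ν := ν) (I := Fin k)
    (G := fun m x => (isolatedCount k r A x m : ℝ≥0∞)) hX_meas hN_meas hN_law hN_indep
    (measurable_cast_isolatedCount k r hA) (B := simplexSet (Fin k) r A)
    (measurableSet_mem_nearby r) (c := fun m => m.choose k) (K := k.factorial) (fun m => ?_)
    (fun m => ?_)
  · rw [h, Fintype.card_fin]
  · rw [Fintype.card_fin, Nat.descFactorial_eq_factorial_mul_choose, Nat.cast_mul]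
  · rw [lintegral_isolatedCount hX_meas hX_indep hX_law k r hA, Fintype.card_fin]

lemma lintegral_disjointPairCount_poisson (hX_meas : ∀ i, Measurable (X i))
    (hX_indep : iIndepFun X P) (hX_law : ∀ i, P.map (X i) = ν) (hN_meas : Measurable N)
    (hN_law : P.map N = poissonMeasure n) (hN_indep : IndepFun N (fun ω i => X i ω) P)
    (k : ℕ) (r : ℝ) {A : Set E} (hA : MeasurableSet A) :
    ((k.factorial * k.factorial : ℕ) : ℝ≥0∞) *
        ∫⁻ ω, (disjointPairCount k r A (fun i => X i ω) (N ω) : ℝ≥0∞) ∂P =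
      ∫⁻ w in simplexPairSet k r A,
        ENNReal.ofReal (n ^ (k + k) * Real.exp (-n * ν.real (nearby r w)))
          ∂Measure.pi fun _ : Fin k ⊕ Fin k => ν := by
  have h := lintegral_poisson_avoiding (ν := ν) (I := Fin k ⊕ Fin k)
    (G := fun m x => (disjointPairCount k r A x m : ℝ≥0∞)) hX_meas hN_meas hN_law hN_indep
    (measurable_cast_disjointPairCount k r hA) (B := simplexPairSet k r A)
    (measurableSet_mem_nearby r) (c := fun m => ((m.choose k * (m - k).choose k : ℕ) : ℝ≥0∞))
    (K := ((k.factorial * k.factorial : ℕ) : ℝ≥0∞)) (fun m => ?_) (fun m => ?_)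
  · rw [h, Fintype.card_sum, Fintype.card_fin]
  -- The falling factorial of length `2k` splits as that of `m` of length `k` times that of `m - k`
  -- of length `k`.
  · rw [Fintype.card_sum, Fintype.card_fin,
      ← Nat.descFactorial_mul_descFactorial (Nat.le_add_left k k), Nat.add_sub_cancel,
      Nat.descFactorial_eq_factorial_mul_choose, Nat.descFactorial_eq_factorial_mul_choose,
      ← Nat.cast_mul]
    congr 1
    ring
  · rw [lintegral_disjointPairCount hX_meas hX_indep hX_law k r hA, Fintype.card_sum,
      Fintype.card_fin]

end Counts

/-! ### Mean, variance and the decoupling estimate. -/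

section Moments

open scoped ENNReal NNReal

/-- The bound on `g` makes the right side of `h` finite, which forces integrability of the count.
The finite second moment comes from applying this to the count and to the pair count. -/
lemma integral_natCast_of_lintegral_eq {Ω β : Type*} [MeasurableSpace Ω] [MeasurableSpace β]
    {P : Measure Ω} {π : Measure β} [IsFiniteMeasure π] {c : Ω → ℕ} (hc : Measurable c) {K : ℕ}
    (hK : K ≠ 0) {B : Set β} {g : β → ℝ} (hg : Measurable g) (hg0 : ∀ y, 0 ≤ g y) {M : ℝ}
    (hgM : ∀ y, g y ≤ M)
    (h : (K : ℝ≥0∞) * ∫⁻ ω, (c ω : ℝ≥0∞) ∂P = ∫⁻ y in B, ENNReal.ofReal (g y) ∂π) :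
    Integrable (fun ω => (c ω : ℝ)) P ∧ K * ∫ ω, (c ω : ℝ) ∂P = ∫ y in B, g y ∂π := by
  have hcm : Measurable fun ω => (c ω : ℝ) := measurable_from_nat.comp hc
  have hfin : ∫⁻ y in B, ENNReal.ofReal (g y) ∂π ≠ ∞ := by
    refine ne_top_of_le_ne_top ?_ (lintegral_mono fun y => ENNReal.ofReal_le_ofReal (hgM y))
    rw [lintegral_const]
    finiteness
  have hfin' : ∫⁻ ω, (c ω : ℝ≥0∞) ∂P ≠ ∞ := by
    intro h'
    rw [h', ENNReal.mul_top (by exact_mod_cast hK)] at h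
    exact hfin h.symm
  have hof : ∀ ω, ENNReal.ofReal (c ω : ℝ) = c ω := fun ω => ENNReal.ofReal_natCast _
  refine ⟨⟨hcm.aestronglyMeasurable, ?_⟩, ?_⟩
  · rw [hasFiniteIntegral_iff_ofReal (ae_of_all _ fun ω => Nat.cast_nonneg _)]
    simp_rw [hof]
    exact hfin'.lt_top
  · rw [integral_eq_lintegral_of_nonneg_ae (ae_of_all _ fun ω => Nat.cast_nonneg _)
      hcm.aestronglyMeasurable, integral_eq_lintegral_of_nonneg_ae (ae_of_all _ hg0)
      hg.aestronglyMeasurable, ← h, ENNReal.toReal_mul, ENNReal.toReal_natCast]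
    simp_rw [hof]

variable {d : ℕ}

local notation "E" => EuclideanSpace ℝ (Fin d)

lemma measurable_measureReal_nearby {ι : Type*} [Fintype ι] (ν : Measure E) [IsFiniteMeasure ν]
    (r : ℝ) : Measurable fun y : ι → E => ν.real (nearby r y) :=
  (measurable_measure_prodMk_left (measurableSet_mem_nearby r)).ennreal_toReal

variable {Ω : Type*} [MeasurableSpace Ω] {P : Measure Ω}
  [IsProbabilityMeasure P] {X : ℕ → Ω → EuclideanSpace ℝ (Fin d)}
  {ν : Measure (EuclideanSpace ℝ (Fin d))} [IsProbabilityMeasure ν] {N : Ω → ℕ} {n : ℝ≥0}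

lemma measurable_of_measurable_cast {c : (ℕ → EuclideanSpace ℝ (Fin d)) → ℕ → ℕ}
    (hc : ∀ m, Measurable fun x => (c x m : ℝ≥0∞)) (hX_meas : ∀ i, Measurable (X i))
    (hN_meas : Measurable N) : Measurable fun ω => c (fun i => X i ω) (N ω) := by
  have h1 : ∀ m, Measurable fun x => c x m := by
    intro m
    have : (fun x => c x m) = fun x => ⌊((c x m : ℝ≥0∞)).toReal⌋₊ := by
      ext x; simp
    rw [this]
    exact Nat.measurable_floor.comp (hc m).ennreal_toReal
  have h2 : Measurable fun p : ℕ × (ℕ → EuclideanSpace ℝ (Fin d)) => c p.2 p.1 :=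
    measurable_from_prod_countable_right h1
  exact h2.comp (hN_meas.prodMk (by fun_prop : Measurable fun ω i => X i ω))

/-- The mean and the variance of the number of isolated empty simplices in a Poisson sample. -/
lemma moments_isolatedCount (hX_meas : ∀ i, Measurable (X i)) (hX_indep : iIndepFun X P)
    (hX_law : ∀ i, P.map (X i) = ν) (hN_meas : Measurable N) (hN_law : P.map N = poissonMeasure n)
    (hN_indep : IndepFun N (fun ω i => X i ω) P) {k : ℕ} (hk : 3 ≤ k) (r : ℝ) {A : Set E}
    (hA : MeasurableSet A) :
    MemLp (fun ω => (isolatedCount k r A (fun i => X i ω) (N ω) : ℝ)) 2 P ∧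
    k.factorial * ∫ ω, (isolatedCount k r A (fun i => X i ω) (N ω) : ℝ) ∂P =
      n ^ k * ∫ y in simplexSet (Fin k) r A, Real.exp (-n * ν.real (nearby r y))
        ∂(Measure.pi fun _ : Fin k => ν) ∧
    (k.factorial : ℝ) ^ 2 *
      (variance (fun ω => (isolatedCount k r A (fun i => X i ω) (N ω) : ℝ)) P -
        ∫ ω, (isolatedCount k r A (fun i => X i ω) (N ω) : ℝ) ∂P) =
      (n ^ k) ^ 2 * (∫ w in simplexPairSet k r A, Real.exp (-n * ν.real (nearby r w))
          ∂(Measure.pi fun _ : Fin k ⊕ Fin k => ν) -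
        (∫ y in simplexSet (Fin k) r A, Real.exp (-n * ν.real (nearby r y))
          ∂Measure.pi fun _ : Fin k => ν) ^ 2) := by
  have hSm := measurable_of_measurable_cast (measurable_cast_isolatedCount k r hA) hX_meas hN_meas
  have hDm := measurable_of_measurable_cast (measurable_cast_disjointPairCount k r hA) hX_meas
    hN_meas
  have hexp : ∀ t : ℝ, 0 ≤ t → Real.exp (-n * t) ≤ 1 := fun t ht => by
    rw [Real.exp_le_one_iff, neg_mul]
    exact neg_nonpos.2 (mul_nonneg n.2 ht)
  have hle : ∀ (l : ℕ) (t : ℝ), 0 ≤ t → (n : ℝ) ^ l * Real.exp (-n * t) ≤ n ^ l := fun l t ht =>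
    mul_le_of_le_one_right (by positivity) (hexp t ht)
  obtain ⟨hS1, hS2⟩ := integral_natCast_of_lintegral_eq hSm (Nat.factorial_ne_zero k)
    (((measurable_measureReal_nearby ν r).const_mul _).exp.const_mul _) (fun y => by positivity)
    (fun y => hle k _ measureReal_nonneg)
    (lintegral_isolatedCount_poisson hX_meas hX_indep hX_law hN_meas hN_law hN_indep k r hA)
  obtain ⟨hD1, hD2⟩ := integral_natCast_of_lintegral_eq hDm
    (mul_ne_zero (Nat.factorial_ne_zero k) (Nat.factorial_ne_zero k))
    (((measurable_measureReal_nearby ν r).const_mul _).exp.const_mul _) (fun y => by positivity)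
    (fun y => hle (k + k) _ measureReal_nonneg)
    (lintegral_disjointPairCount_poisson hX_meas hX_indep hX_law hN_meas hN_law hN_indep k r hA)
  rw [integral_const_mul] at hS2 hD2
  have hsq : ∀ ω, (isolatedCount k r A (fun i => X i ω) (N ω) : ℝ) ^ 2 =
      isolatedCount k r A (fun i => X i ω) (N ω) +
        disjointPairCount k r A (fun i => X i ω) (N ω) := fun ω => by
    exact_mod_cast isolatedCount_sq hk r A (fun i => X i ω) (N ω)
  have hmem : MemLp (fun ω => (isolatedCount k r A (fun i => X i ω) (N ω) : ℝ)) 2 P := by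
    rw [memLp_two_iff_integrable_sq hS1.aestronglyMeasurable]
    simp_rw [hsq]
    exact hS1.add hD1
  refine ⟨hmem, hS2, ?_⟩
  rw [variance_eq_sub hmem]
  simp only [Pi.pow_apply, hsq]
  rw [integral_add hS1 hD1]
  push_cast at hD2
  rw [pow_add] at hD2
  set a := ∫ ω, (isolatedCount k r A (fun i => X i ω) (N ω) : ℝ) ∂P
  set b := ∫ y in simplexSet (Fin k) r A, Real.exp (-n * ν.real (nearby r y))
    ∂(Measure.pi fun _ : Fin k => ν)
  -- The variance minus the mean is `E D - a ^ 2`; the cofactor of `hS2` comes from factoring `(k!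
  -- a)² - (n^k b)²`.
  linear_combination hD2 - (k.factorial * a + n ^ k * b) * hS2

/-- On the product space the pair integral can be compared with the square of the mean integral
under one integral sign. -/
lemma setIntegral_simplexPairSet {k : ℕ} (r : ℝ) (A : Set E) (n : ℝ) :
    ∫ w in simplexPairSet k r A, Real.exp (-n * ν.real (nearby r w))
        ∂(Measure.pi fun _ : Fin k ⊕ Fin k => ν) =
      ∫ p in {p : (Fin k → E) × (Fin k → E) | p.1 ∈ simplexSet (Fin k) r A ∧
          p.2 ∈ simplexSet (Fin k) r A ∧ ∀ i j, ¬ dist (p.1 i) (p.2 j) ≤ 2 * r},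
        Real.exp (-n * ν.real (nearby r p.1 ∪ nearby r p.2))
        ∂((Measure.pi fun _ : Fin k => ν).prod (Measure.pi fun _ : Fin k => ν)) := by
  have hmp := measurePreserving_sumPiEquivProdPi (fun _ : Fin k ⊕ Fin k => ν)
  rw [← hmp.setIntegral_preimage_emb (MeasurableEquiv.measurableEmbedding _)]
  have : ∀ w : Fin k ⊕ Fin k → E, nearby r w =
      nearby r (MeasurableEquiv.sumPiEquivProdPi (fun _ => E) w).1 ∪
        nearby r (MeasurableEquiv.sumPiEquivProdPi (fun _ => E) w).2 := fun w =>
    Set.iUnion_sum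
  simp_rw [this]
  rfl

/-- The dependence between two configurations only comes from those which are close. -/
lemma abs_pair_sub_sq_le {k : ℕ} (hk : 3 ≤ k) {r : ℝ} (hr : 0 ≤ r) {A : Set E}
    (hA : MeasurableSet A) {n : ℝ} (hn : 0 ≤ n) {b : ℝ}
    (hb : ∀ x, ν.real (Metric.closedBall x (8 * r)) ≤ b) :
    |∫ w in simplexPairSet k r A, Real.exp (-n * ν.real (nearby r w))
          ∂(Measure.pi fun _ : Fin k ⊕ Fin k => ν) -
        (∫ y in simplexSet (Fin k) r A, Real.exp (-n * ν.real (nearby r y))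
          ∂Measure.pi fun _ : Fin k => ν) ^ 2| ≤
      (Measure.pi fun _ : Fin k => ν).real (simplexSet (Fin k) r A) * b ^ k := by
  have hb0 : 0 ≤ b := measureReal_nonneg.trans (hb 0)
  set π := Measure.pi fun _ : Fin k => ν with hπ
  set Φ := simplexSet (Fin k) r A with hΦ_def
  have hΦ : MeasurableSet Φ := measurableSet_simplexSet r hA
  set Q : Set ((Fin k → E) × (Fin k → E)) :=
    {p | p.1 ∈ Φ ∧ p.2 ∈ Φ ∧ ∀ i j, ¬ dist (p.1 i) (p.2 j) ≤ 2 * r} with hQ_def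
  have hdistm : ∀ i j, Measurable fun p : (Fin k → E) × (Fin k → E) => dist (p.1 i) (p.2 j) :=
    fun i j => by fun_prop
  have hQ : MeasurableSet Q := by
    have : Q = Prod.fst ⁻¹' Φ ∩ (Prod.snd ⁻¹' Φ ∩ ⋂ i, ⋂ j,
        {p : (Fin k → E) × (Fin k → E) | dist (p.1 i) (p.2 j) ≤ 2 * r}ᶜ) := by
      ext; simp [hQ_def]
    rw [this]
    exact (measurable_fst hΦ).inter ((measurable_snd hΦ).inter (MeasurableSet.iInter fun i =>
      MeasurableSet.iInter fun j => (measurableSet_le (hdistm i j) measurable_const).compl))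
  set i₀ : Fin k := ⟨0, by omega⟩
  -- `C` contains all pairs in `Φ` with some mutual distance at most `4r`: from `p.1 i₀` to any `p.2
  -- l` is then at most `2r + 4r + 2r`, two diameters and a gap.
  set C : Set ((Fin k → E) × (Fin k → E)) :=
    {p | p.1 ∈ Φ ∧ ∀ j, p.2 j ∈ Metric.closedBall (p.1 i₀) (8 * r)} with hC_def
  have hC : MeasurableSet C := by
    have : C = Prod.fst ⁻¹' Φ ∩ ⋂ j,
        {p : (Fin k → E) × (Fin k → E) | dist (p.1 i₀) (p.2 j) ≤ 8 * r} := by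
      ext; simp [hC_def, dist_comm]
    rw [this]
    exact (measurable_fst hΦ).inter (MeasurableSet.iInter fun j =>
      measurableSet_le (hdistm i₀ j) measurable_const)
  set u : (Fin k → E) → ℝ := fun y => Real.exp (-n * ν.real (nearby r y)) with hu_def
  set v : (Fin k → E) × (Fin k → E) → ℝ := fun p =>
    Real.exp (-n * ν.real (nearby r p.1 ∪ nearby r p.2)) with hv_def
  have hexp : ∀ t : ℝ, 0 ≤ t → Real.exp (-n * t) ≤ 1 := fun t ht => by
    rw [Real.exp_le_one_iff, neg_mul]
    exact neg_nonpos.2 (mul_nonneg hn ht)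
  have hu0 : ∀ y, 0 ≤ u y := fun y => (Real.exp_pos _).le
  have hu1 : ∀ y, u y ≤ 1 := fun y => hexp _ measureReal_nonneg
  have hv0 : ∀ p, 0 ≤ v p := fun p => (Real.exp_pos _).le
  have hv1 : ∀ p, v p ≤ 1 := fun p => hexp _ measureReal_nonneg
  have hum : Measurable u := ((measurable_measureReal_nearby ν r).const_mul _).exp
  have hvm : Measurable v := by
    have h1 : MeasurableSet {q : ((Fin k → E) × (Fin k → E)) × E |
        q.2 ∈ nearby r q.1.1 ∪ nearby r q.1.2} :=
      ((measurableSet_mem_nearby r).preimage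
        (f := fun q : ((Fin k → E) × (Fin k → E)) × E => (q.1.1, q.2)) (by fun_prop)).union
      ((measurableSet_mem_nearby r).preimage
        (f := fun q : ((Fin k → E) × (Fin k → E)) × E => (q.1.2, q.2)) (by fun_prop))
    have h2 : Measurable fun p : (Fin k → E) × (Fin k → E) =>
        ν.real (nearby r p.1 ∪ nearby r p.2) :=
      (measurable_measure_prodMk_left h1).ennreal_toReal
    exact (h2.const_mul _).exp
  set w : (Fin k → E) × (Fin k → E) → ℝ := fun p => Φ.indicator u p.1 * Φ.indicator u p.2 with hw_def
  have hwm : Measurable w :=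
    ((hum.indicator hΦ).comp measurable_fst).mul ((hum.indicator hΦ).comp measurable_snd)
  have hiu0 : ∀ y, 0 ≤ Φ.indicator u y := fun y => Set.indicator_nonneg (fun y _ => hu0 y) y
  have hiu1 : ∀ y, Φ.indicator u y ≤ 1 := fun y =>
    Set.indicator_apply_le' (fun _ => hu1 y) fun _ => zero_le_one
  have hw0 : ∀ p, 0 ≤ w p := fun p => mul_nonneg (hiu0 _) (hiu0 _)
  have hw1 : ∀ p, w p ≤ 1 := fun p => mul_le_one₀ (hiu1 _) (hiu0 _) (hiu1 _)
  have hiv0 : ∀ p, 0 ≤ Q.indicator v p := fun p => Set.indicator_nonneg (fun y _ => hv0 y) p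
  have hiv1 : ∀ p, Q.indicator v p ≤ 1 := fun p =>
    Set.indicator_apply_le' (fun _ => hv1 p) fun _ => zero_le_one
  have hint : ∀ g : (Fin k → E) × (Fin k → E) → ℝ, Measurable g → (∀ p, 0 ≤ g p) →
      (∀ p, g p ≤ 1) → Integrable g (π.prod π) := fun g hg h0 h1 =>
    Integrable.of_bound hg.aestronglyMeasurable 1 (ae_of_all _ fun p => by
      rw [Real.norm_of_nonneg (h0 p)]; exact h1 p)
  -- Off `C`, mutual distances exceed `4r`, so the two `2r`-neighbourhoods are disjoint and the
  -- exponential factorises exactly. On `C` both terms lie in `[0, 1]`.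
  have hkey : ∀ p, |Q.indicator v p - w p| ≤ C.indicator 1 p := by
    intro p
    by_cases hpC : p ∈ C
    · rw [Set.indicator_of_mem hpC, Pi.one_apply, abs_le]
      constructor <;> linarith [hw0 p, hw1 p, hiv0 p, hiv1 p]
    · rw [Set.indicator_of_notMem hpC, abs_nonpos_iff, sub_eq_zero]
      by_cases hp : p.1 ∈ Φ ∧ p.2 ∈ Φ
      · have hfar : ∀ i j, 4 * r < dist (p.1 i) (p.2 j) := by
          intro i j
          by_contra! hij
          refine hpC ⟨hp.1, fun l => ?_⟩
          have hcard : 3 ≤ (Finset.univ : Finset (Fin k)).card := by simpa using hk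
          have h1 := hp.1.1.dist_le hcard (Finset.mem_univ i₀) (Finset.mem_univ i)
          have h2 := hp.2.1.dist_le hcard (Finset.mem_univ j) (Finset.mem_univ l)
          have h3 := dist_triangle4 (p.1 i₀) (p.1 i) (p.2 j) (p.2 l)
          rw [Metric.mem_closedBall, dist_comm]
          linarith
        have hpQ : p ∈ Q := ⟨hp.1, hp.2, fun i j h => by linarith [hfar i j]⟩
        have hdisj : Disjoint (nearby r p.1) (nearby r p.2) := by
          rw [Set.disjoint_left]
          intro z hz1 hz2
          obtain ⟨i, hi⟩ := mem_nearby.1 hz1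
          obtain ⟨j, hj⟩ := mem_nearby.1 hz2
          have := dist_triangle_right (p.1 i) (p.2 j) z
          linarith [hfar i j]
        simp only [hw_def, hv_def, hu_def]
        rw [Set.indicator_of_mem hpQ, Set.indicator_of_mem hp.1, Set.indicator_of_mem hp.2,
          measureReal_union hdisj (measurableSet_nearby r _), mul_add, Real.exp_add]
      · have hpQ : p ∉ Q := fun h => hp ⟨h.1, h.2.1⟩
        rw [Set.indicator_of_notMem hpQ]
        simp only [hw_def]
        rw [not_and_or] at hp
        rcases hp with hp | hp <;> simp [Set.indicator_of_notMem hp]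
  -- For a fixed first configuration, each of the `k` points of the second lies in one fixed ball of
  -- measure at most `b`.
  have hmeasC : (π.prod π) C ≤ π Φ * ENNReal.ofReal b ^ k := by
    rw [Measure.prod_apply hC]
    calc ∫⁻ y, π (Prod.mk y ⁻¹' C) ∂π
        ≤ ∫⁻ y, Φ.indicator (fun _ => ENNReal.ofReal b ^ k) y ∂π := by
          refine lintegral_mono fun y => ?_
          by_cases hy : y ∈ Φ
          · rw [Set.indicator_of_mem hy]
            have : Prod.mk y ⁻¹' C = Set.univ.pi fun _ : Fin k =>
                Metric.closedBall (y i₀) (8 * r) := by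
              ext z; simp [hC_def, hy]
            rw [this, hπ, Measure.pi_pi, Finset.prod_const, Finset.card_univ, Fintype.card_fin]
            gcongr
            rw [← ofReal_measureReal]
            exact ENNReal.ofReal_le_ofReal (hb _)
          · rw [Set.indicator_of_notMem hy]
            have : Prod.mk y ⁻¹' C = ∅ := by
              ext z; simp [hC_def, hy]
            rw [this, measure_empty]
      _ = π Φ * ENNReal.ofReal b ^ k := by
          rw [lintegral_indicator hΦ, setLIntegral_const, mul_comm]
  rw [setIntegral_simplexPairSet r A, ← integral_indicator hQ, ← integral_indicator hΦ, sq,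
    ← integral_prod_mul, ← integral_sub (hint _ (hvm.indicator hQ) hiv0 hiv1) (hint _ hwm hw0 hw1)]
  calc |∫ p, (Q.indicator v p - w p) ∂π.prod π|
      ≤ ∫ p, |Q.indicator v p - w p| ∂π.prod π := abs_integral_le_integral_abs
    _ ≤ ∫ p, C.indicator 1 p ∂π.prod π := by
        refine integral_mono_of_nonneg (ae_of_all _ fun p => abs_nonneg _) ?_ (ae_of_all _ hkey)
        exact (integrable_const (1 : ℝ)).indicator hC
    _ = (π.prod π).real C := integral_indicator_one hC
    _ ≤ π.real Φ * b ^ k := by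
        rw [measureReal_def]
        refine (ENNReal.toReal_mono (by finiteness) hmeasC).trans_eq ?_
        rw [ENNReal.toReal_mul, ENNReal.toReal_pow, ENNReal.toReal_ofReal hb0, measureReal_def]

/-- The neighbourhood is a union of `k` balls of radius `2r ≤ 8r`, so its measure lies between `0`
and `k b`. -/
lemma mean_integral_bounds {k : ℕ} {r : ℝ} (hr : 0 ≤ r) {A : Set E} (hA : MeasurableSet A)
    {n : ℝ} (hn : 0 ≤ n) {b : ℝ} (hb : ∀ x, ν.real (Metric.closedBall x (8 * r)) ≤ b) :
    Real.exp (-n * (k * b)) * (Measure.pi fun _ : Fin k => ν).real (simplexSet (Fin k) r A) ≤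
      ∫ y in simplexSet (Fin k) r A, Real.exp (-n * ν.real (nearby r y))
        ∂(Measure.pi fun _ : Fin k => ν) ∧
    ∫ y in simplexSet (Fin k) r A, Real.exp (-n * ν.real (nearby r y))
        ∂(Measure.pi fun _ : Fin k => ν) ≤
      (Measure.pi fun _ : Fin k => ν).real (simplexSet (Fin k) r A) := by
  set π := Measure.pi fun _ : Fin k => ν
  have hexp : ∀ t : ℝ, 0 ≤ t → Real.exp (-n * t) ≤ 1 := fun t ht => by
    rw [Real.exp_le_one_iff, neg_mul]
    exact neg_nonpos.2 (mul_nonneg hn ht)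
  have hΦ : MeasurableSet (simplexSet (Fin k) r A) := measurableSet_simplexSet r hA
  have hum : Measurable fun y : Fin k → E => Real.exp (-n * ν.real (nearby r y)) :=
    ((measurable_measureReal_nearby ν r).const_mul _).exp
  have hint : Integrable (fun y : Fin k → E => Real.exp (-n * ν.real (nearby r y))) π :=
    Integrable.of_bound hum.aestronglyMeasurable 1 (ae_of_all _ fun p => by
      rw [Real.norm_of_nonneg (Real.exp_pos _).le]; exact hexp _ measureReal_nonneg)
  constructor
  · have h1 : ∫ y in simplexSet (Fin k) r A, Real.exp (-n * (k * b)) ∂π =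
        Real.exp (-n * (k * b)) * π.real (simplexSet (Fin k) r A) := by
      rw [setIntegral_const, smul_eq_mul, mul_comm]
    rw [← h1]
    refine setIntegral_mono (integrable_const _).integrableOn hint.integrableOn fun y => ?_
    refine Real.exp_le_exp.2 ?_
    rw [neg_mul, neg_mul, neg_le_neg_iff]
    refine mul_le_mul_of_nonneg_left ?_ hn
    calc ν.real (nearby r y) ≤ ∑ i, ν.real (Metric.closedBall (y i) (2 * r)) :=
          measureReal_iUnion_fintype_le _
      _ ≤ ∑ _i : Fin k, b := Finset.sum_le_sum fun i _ =>
          (measureReal_mono (Metric.closedBall_subset_closedBall (by linarith))).trans (hb _)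
      _ = k * b := by simp
  · have h1 : ∫ y in simplexSet (Fin k) r A, (1 : ℝ) ∂π = π.real (simplexSet (Fin k) r A) := by
      rw [setIntegral_const, smul_eq_mul, mul_one]
    rw [← h1]
    exact setIntegral_mono hint.integrableOn (integrable_const _).integrableOn fun y =>
      hexp _ measureReal_nonneg

end Moments

/-! ### Densities and the limit of the integral over positions for a fixed shape. -/

section Analysis

open scoped ENNReal NNReal

/-- It suffices to compare boxes, on which the integral of the product density is a product of
integrals. -/
lemma pi_withDensity_ofReal {ι α : Type*} [Fintype ι] [MeasurableSpace α] (μ : Measure α)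
    [SigmaFinite μ] {f : α → ℝ} (hf : Integrable f μ) (hf0 : ∀ x, 0 ≤ f x)
    [SigmaFinite (μ.withDensity fun x => ENNReal.ofReal (f x))] :
    (Measure.pi fun _ : ι => μ.withDensity fun x => ENNReal.ofReal (f x)) =
      (Measure.pi fun _ : ι => μ).withDensity fun y => ENNReal.ofReal (∏ i, f (y i)) := by
  refine Measure.pi_eq fun s hs => ?_
  have hi : ∀ i, Integrable ((s i).indicator f) μ := fun i => hf.indicator (hs i)
  have hi0 : ∀ i x, 0 ≤ (s i).indicator f x := fun i x => Set.indicator_nonneg (fun x _ => hf0 x) x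
  have h1 : ∀ y : ι → α, (Set.univ.pi s).indicator (fun y => ENNReal.ofReal (∏ i, f (y i))) y =
      ENNReal.ofReal (∏ i, (s i).indicator f (y i)) := by
    intro y
    by_cases hy : y ∈ Set.univ.pi s
    · rw [Set.indicator_of_mem hy]
      congr 1
      exact Finset.prod_congr rfl fun i _ => (Set.indicator_of_mem (hy i (Set.mem_univ i)) f).symm
    · rw [Set.indicator_of_notMem hy]
      obtain ⟨i, hi⟩ : ∃ i, y i ∉ s i := by
        simpa [Set.mem_pi] using hy
      rw [Finset.prod_eq_zero (Finset.mem_univ i) (Set.indicator_of_notMem hi f),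
        ENNReal.ofReal_zero]
  rw [withDensity_apply _ (MeasurableSet.univ_pi hs), ← lintegral_indicator (MeasurableSet.univ_pi hs)]
  simp_rw [h1]
  rw [← ofReal_integral_eq_lintegral_ofReal (Integrable.fintype_prod hi)
    (ae_of_all _ fun y => Finset.prod_nonneg fun i _ => hi0 i _), integral_fintype_prod_eq_prod,
    ENNReal.ofReal_prod_of_nonneg fun i _ => integral_nonneg (hi0 i)]
  refine Finset.prod_congr rfl fun i _ => ?_
  rw [ofReal_integral_eq_lintegral_ofReal (hi i) (ae_of_all _ (hi0 i)), withDensity_apply _ (hs i),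
    ← lintegral_indicator (hs i)]
  refine lintegral_congr fun x => ?_
  by_cases hx : x ∈ s i <;> simp [hx]

/-- Telescoping, one factor at a time. `1 ≤ C` allows a single power of `C` to bound every term. -/
lemma abs_prod_sub_prod_le {ι : Type*} (s : Finset ι) {a b : ι → ℝ} {C : ℝ} (hC : 1 ≤ C)
    (ha : ∀ i, |a i| ≤ C) (hb : ∀ i, |b i| ≤ C) :
    |∏ i ∈ s, a i - ∏ i ∈ s, b i| ≤ C ^ s.card * ∑ i ∈ s, |a i - b i| := by
  classical
  induction s using Finset.induction_on with
  | empty => simp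
  | insert j s hj ih =>
    rw [Finset.prod_insert hj, Finset.prod_insert hj, Finset.sum_insert hj,
      Finset.card_insert_of_notMem hj]
    have h1 : a j * ∏ i ∈ s, a i - b j * ∏ i ∈ s, b i =
        a j * (∏ i ∈ s, a i - ∏ i ∈ s, b i) + (a j - b j) * ∏ i ∈ s, b i := by ring
    have h2 : |∏ i ∈ s, b i| ≤ C ^ s.card := by
      rw [Finset.abs_prod]
      exact (Finset.prod_le_prod (fun i _ => abs_nonneg _) fun i _ => hb i).trans_eq (by simp)
    have h3 : C ^ s.card ≤ C ^ (s.card + 1) := pow_le_pow_right₀ hC (Nat.le_succ _)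
    calc |a j * ∏ i ∈ s, a i - b j * ∏ i ∈ s, b i|
        ≤ |a j| * |∏ i ∈ s, a i - ∏ i ∈ s, b i| + |a j - b j| * |∏ i ∈ s, b i| := by
          rw [h1, ← abs_mul, ← abs_mul]
          exact abs_add_le _ _
      _ ≤ C * (C ^ s.card * ∑ i ∈ s, |a i - b i|) + |a j - b j| * C ^ (s.card + 1) := by
          gcongr
          · exact ha j
          · exact h2.trans h3
      _ = C ^ (s.card + 1) * (|a j - b j| + ∑ i ∈ s, |a i - b i|) := by ring

/-- Continuity of translations in `L¹`. -/
lemma tendsto_integral_abs_translate_sub {F : Type*} [NormedAddCommGroup F] [NormedSpace ℝ F]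
    [FiniteDimensional ℝ F] [MeasurableSpace F] [BorelSpace F] (μ : Measure F)
    [μ.IsAddHaarMeasure] {f : F → ℝ} (hf : Integrable f μ) :
    Tendsto (fun h => ∫ x, |f (x + h) - f x| ∂μ) (𝓝 0) (𝓝 0) := by
  have hcont : Continuous fun h : F => (⟨fun x => x + h, by fun_prop⟩ : C(F, F)) :=
    ((⟨fun p : F × F => p.2 + p.1, by fun_prop⟩ : C(F × F, F)).curry).continuous
  have hmp : ∀ h : F, MeasurePreserving (⟨fun x => x + h, by fun_prop⟩ : C(F, F)) μ μ := fun h =>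
    measurePreserving_add_right μ h
  have hmem : MemLp f 1 μ := memLp_one_iff_integrable.2 hf
  -- Composing a fixed `L¹` function with a continuous family of measure-preserving maps is
  -- continuous in `L¹`; the maps here are translations.
  have hlim := (Continuous.compMeasurePreservingLp (p := 1) (μ := μ) (ν := μ)
    (continuous_const (y := hmem.toLp f)) hcont hmp ENNReal.one_ne_top).tendsto 0
  rw [tendsto_iff_edist_tendsto_0] at hlim
  simp_rw [Lp.toLp_compMeasurePreserving] at hlim
  simp_rw [Lp.edist_toLp_toLp, eLpNorm_one_eq_lintegral_enorm] at hlim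
  have hlim' := (ENNReal.tendsto_toReal ENNReal.zero_ne_top).comp hlim
  rw [ENNReal.toReal_zero] at hlim'
  refine hlim'.congr fun h => ?_
  have hint : Integrable (fun x => f (x + h)) μ := hf.comp_add_right h
  have h0 : ∫ x, |f (x + h) - f x| ∂μ = ∫ x, ‖f (x + h) - f x‖ ∂μ := rfl
  rw [h0, integral_norm_eq_lintegral_enorm (f := fun x => f (x + h) - f x)
    (hint.sub hf).aestronglyMeasurable]
  simp

variable {d : ℕ}

local notation "E" => EuclideanSpace ℝ (Fin d)

/-- Off the frontier, `x` is interior to `A` or to its complement, and the shrinking configuration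
ends up on the same side. Which point is left-most then does not matter. -/
lemma eventually_leftMostIn_iff {ι : Type*} [Fintype ι] [Nonempty ι] {A : Set E} (hA : IsOpen A)
    {x : E} (hx : x ∉ frontier A) {r : ℕ → ℝ} (hr : Tendsto r atTop (𝓝 0)) (w : ι → E) :
    ∀ᶠ n in atTop, (LeftMostIn A Finset.univ (fun i => x + r n • w i) ↔ x ∈ A) := by
  have hlim : ∀ i, Tendsto (fun n => x + r n • w i) atTop (𝓝 x) := fun i => by
    simpa using tendsto_const_nhds.add (hr.smul_const (w i))
  by_cases hxA : x ∈ A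
  · filter_upwards [eventually_all.2 fun i => (hlim i).eventually (hA.mem_nhds hxA)] with n hn
    exact iff_of_true (leftMostIn_of_forall_mem Finset.univ_nonempty fun i _ => hn i) hxA
  · have hxc : x ∉ closure A := fun h => hx ⟨h, fun h' => hxA (interior_subset h')⟩
    filter_upwards [eventually_all.2 fun i =>
      (hlim i).eventually (isClosed_closure.isOpen_compl.mem_nhds hxc)] with n hn
    exact iff_of_false (fun ⟨j, _, hj, _⟩ => hn j (subset_closure hj)) hxA

/-- The integral over the position of a configuration of given shape `w` and size `r`. -/
noncomputable def shapeIntegral {ι : Type*} [Fintype ι] (f : E → ℝ) (A : Set E) (w : ι → E)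
    (r : ℝ) : ℝ :=
  ∫ x, {x | LeftMostIn A Finset.univ fun i => x + r • w i}.indicator
    (fun x => ∏ i, f (x + r • w i)) x

section Density

variable {f : EuclideanSpace ℝ (Fin d) → ℝ} {M : ℝ} {A : Set (EuclideanSpace ℝ (Fin d))}

lemma measurableSet_leftMostIn_shape {ι : Type*} [Fintype ι] (hA : MeasurableSet A) (r : ℝ) :
    MeasurableSet {p : (ι → E) × E | LeftMostIn A Finset.univ fun i => p.2 + r • p.1 i} :=
  (measurableSet_leftMostIn hA Finset.univ).preimage
    (f := fun p : (ι → E) × E => fun i => p.2 + r • p.1 i) (by fun_prop)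

/-- The vertex at the origin contributes the integrable factor `f x` and the others at most `M`
each: a dominating function independent of shape and scale. -/
lemma prod_shape_le {m : ℕ} (hf0 : ∀ x, 0 ≤ f x) (hfM : ∀ x, f x ≤ M) {w : Fin (m + 1) → E}
    (hw : w 0 = 0) (r : ℝ) (x : E) : ∏ i, f (x + r • w i) ≤ f x * M ^ m := by
  rw [Fin.prod_univ_succ, hw, smul_zero, add_zero]
  refine mul_le_mul_of_nonneg_left ?_ (hf0 x)
  exact (Finset.prod_le_prod (fun i _ => hf0 _) fun i _ => hfM _).trans_eq (by simp)

lemma integrable_prod_shape {m : ℕ} (hf : Integrable f) (hfm : Measurable f) (hf0 : ∀ x, 0 ≤ f x)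
    (hfM : ∀ x, f x ≤ M) {w : Fin (m + 1) → E} (hw : w 0 = 0) (r : ℝ) :
    Integrable fun x => ∏ i, f (x + r • w i) := by
  refine (hf.mul_const (M ^ m)).mono' ?_ (ae_of_all _ fun x => ?_)
  · exact (Finset.measurable_fun_prod _ fun i _ => hfm.comp (by fun_prop)).aestronglyMeasurable
  · rw [Real.norm_of_nonneg (Finset.prod_nonneg fun i _ => hf0 _)]
    exact prod_shape_le hf0 hfM hw r x

lemma measurableSet_leftMostIn_shape_right {ι : Type*} [Fintype ι] (hA : MeasurableSet A)
    (w : ι → E) (r : ℝ) : MeasurableSet {x | LeftMostIn A Finset.univ fun i => x + r • w i} :=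
  (measurableSet_leftMostIn_shape hA r).preimage (f := fun x => (w, x)) (by fun_prop)

lemma shapeIntegral_le {m : ℕ} (hA : MeasurableSet A) (hf : Integrable f) (hfm : Measurable f)
    (hf0 : ∀ x, 0 ≤ f x) (hfM : ∀ x, f x ≤ M) {w : Fin (m + 1) → E} (hw : w 0 = 0) (r : ℝ) :
    shapeIntegral f A w r ≤ (∫ x, f x) * M ^ m := by
  rw [← integral_mul_const]
  refine integral_mono ((integrable_prod_shape hf hfm hf0 hfM hw r).indicator
    (measurableSet_leftMostIn_shape_right hA w r)) (hf.mul_const _) fun x => ?_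
  refine Set.indicator_apply_le' (fun _ => prod_shape_le hf0 hfM hw r x) fun _ => ?_
  exact mul_nonneg (hf0 x) (pow_nonneg ((hf0 x).trans (hfM x)) m)

/-- As `f` need not be continuous, the product of densities is first replaced by `f x ^ (m + 1)` at
a cost controlled by `L¹`-continuity of translations. Dominated convergence then handles the
left-most condition, using that the frontier is null. -/
lemma tendsto_shapeIntegral {m : ℕ} (hA : IsOpen A) (hA_bdry : volume (frontier A) = 0)
    (hf : Integrable f) (hfm : Measurable f) (hf0 : ∀ x, 0 ≤ f x) (hfM : ∀ x, f x ≤ M)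
    {w : Fin (m + 1) → E} (hw : w 0 = 0) {r : ℕ → ℝ} (hr : Tendsto r atTop (𝓝 0)) :
    Tendsto (fun n => shapeIntegral f A w (r n)) atTop (𝓝 (∫ x in A, f x ^ (m + 1))) := by
  set L : ℕ → Set E := fun n => {x | LeftMostIn A Finset.univ fun i => x + r n • w i} with hL
  have hLm : ∀ n, MeasurableSet (L n) := fun n =>
    measurableSet_leftMostIn_shape_right hA.measurableSet w (r n)
  have hpow_eq : ∀ x, f x ^ (m + 1) = ∏ _i : Fin (m + 1), f x := fun x => by simp
  have hpow_int : Integrable fun x => f x ^ (m + 1) := by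
    -- At scale `0` the product of densities is the power of `f`.
    have := integrable_prod_shape hf hfm hf0 hfM hw 0
    simpa using this
  have h1 : Tendsto (fun n => ∫ x, (L n).indicator (fun x => f x ^ (m + 1)) x) atTop
      (𝓝 (∫ x in A, f x ^ (m + 1))) := by
    rw [← integral_indicator hA.measurableSet]
    refine tendsto_integral_of_dominated_convergence (fun x => f x ^ (m + 1))
      (fun n => (hpow_int.indicator (hLm n)).aestronglyMeasurable) hpow_int
      (fun n => ae_of_all _ fun x => ?_) ?_
    · refine (norm_indicator_le_norm_self _ _).trans_eq (Real.norm_of_nonneg ?_)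
      exact pow_nonneg (hf0 x) _
    · have : ∀ᵐ x, x ∉ frontier A := measure_eq_zero_iff_ae_notMem.1 hA_bdry
      filter_upwards [this] with x hx
      refine tendsto_const_nhds.congr' ?_
      filter_upwards [eventually_leftMostIn_iff hA hx hr w] with n hn
      by_cases hxA : x ∈ A
      · rw [Set.indicator_of_mem hxA, Set.indicator_of_mem (show x ∈ L n from hn.2 hxA)]
      · rw [Set.indicator_of_notMem hxA, Set.indicator_of_notMem (show x ∉ L n from fun h => hxA (hn.1 h))]
  set C := max M 1 with hC
  have hfC : ∀ x, |f x| ≤ C := fun x => by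
    rw [abs_of_nonneg (hf0 x)]
    exact (hfM x).trans (le_max_left _ _)
  have h2 : Tendsto (fun n => C ^ (m + 1) * ∑ i, ∫ x, |f (x + r n • w i) - f x|) atTop (𝓝 0) := by
    have : Tendsto (fun n => C ^ (m + 1) * ∑ i : Fin (m + 1), ∫ x, |f (x + r n • w i) - f x|) atTop
        (𝓝 (C ^ (m + 1) * ∑ _i : Fin (m + 1), 0)) := by
      refine (tendsto_finsetSum _ fun i _ => ?_).const_mul _
      refine (tendsto_integral_abs_translate_sub volume hf).comp ?_
      simpa using hr.smul_const (w i)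
    simpa using this
  have h3 : ∀ n, |shapeIntegral f A w (r n) - ∫ x, (L n).indicator (fun x => f x ^ (m + 1)) x| ≤
      C ^ (m + 1) * ∑ i, ∫ x, |f (x + r n • w i) - f x| := by
    intro n
    have hint : ∀ i, Integrable fun x => |f (x + r n • w i) - f x| := fun i =>
      ((hf.comp_add_right _).sub hf).abs
    rw [shapeIntegral, ← integral_sub ((integrable_prod_shape hf hfm hf0 hfM hw _).indicator (hLm n))
      (hpow_int.indicator (hLm n)), ← integral_finsetSum _ fun i _ => hint i, ← integral_const_mul]
    refine (abs_integral_le_integral_abs).trans ?_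
    refine integral_mono_of_nonneg (ae_of_all _ fun x => abs_nonneg _)
      ((integrable_finsetSum _ fun i _ => hint i).const_mul _) (ae_of_all _ fun x => ?_)
    by_cases hx : x ∈ L n
    · simp only [Set.indicator_of_mem hx]
      rw [hpow_eq]
      have := abs_prod_sub_prod_le Finset.univ (a := fun i => f (x + r n • w i)) (b := fun _ => f x)
        (le_max_right M 1) (fun i => hfC _) (fun i => hfC _)
      simpa using this
    · simp only [Set.indicator_of_notMem hx, sub_zero, abs_zero]
      exact mul_nonneg (by positivity) (Finset.sum_nonneg fun i _ => abs_nonneg _)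
  have h4 := squeeze_zero_norm (fun n => (Real.norm_eq_abs _).trans_le (h3 n)) h2
  simpa using h4.add h1

end Density

end Analysis

/-! ### Scaling of the simplex probability. -/

section ScalingLimit

open scoped ENNReal NNReal

variable {d : ℕ}

local notation "E" => EuclideanSpace ℝ (Fin d)

lemma lintegral_comp_add_smul {F : Type*} [NormedAddCommGroup F] [NormedSpace ℝ F]
    [FiniteDimensional ℝ F] [MeasurableSpace F] [BorelSpace F] (μ : Measure F)
    [μ.IsAddHaarMeasure] (H : F → ℝ≥0∞) (c : F) {r : ℝ} (hr : 0 < r) :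
    ∫⁻ z, H z ∂μ = ENNReal.ofReal (r ^ Module.finrank ℝ F) * ∫⁻ z, H (c + r • z) ∂μ := by
  have h1 : ∫⁻ z, H (c + r • z) ∂μ = ∫⁻ z, H (c + z) ∂(μ.map (r • ·)) :=
    ((Homeomorph.smulOfNeZero r hr.ne').measurableEmbedding.lintegral_map
      fun z => H (c + z)).symm
  rw [h1, Measure.map_addHaar_smul μ hr.ne', lintegral_smul_measure, smul_eq_mul, ← mul_assoc,
    ← ENNReal.ofReal_mul (by positivity), abs_of_pos (by positivity),
    mul_inv_cancel₀ (by positivity), ENNReal.ofReal_one, one_mul, lintegral_add_left_eq_self]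

/-- The first point is kept as `x` and the other `m` are written `x + r z`, which gives the Jacobian
`r^(dm)`. Swapping the integrals puts the shape `z` outside. -/
lemma lintegral_fin_succ_scaling {m : ℕ} {G : (Fin (m + 1) → E) → ℝ≥0∞} (hG : Measurable G)
    {r : ℝ} (hr : 0 < r) :
    ∫⁻ y, G y = ENNReal.ofReal (r ^ (d * m)) * ∫⁻ z : Fin m → E, ∫⁻ x : E,
      G fun i => x + r • (Fin.cons 0 z : Fin (m + 1) → E) i := by
  have hmp := (volume_preserving_piFinSuccAbove (fun _ : Fin (m + 1) => E) 0).symm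
  have hcons : Measurable fun p : E × (Fin m → E) => (Fin.cons p.1 p.2 : Fin (m + 1) → E) := by
    refine measurable_pi_iff.2 (Fin.cases ?_ fun i => ?_)
    · simpa using measurable_fst
    · simp only [Fin.cons_succ]
      fun_prop
  have hshift : Measurable fun p : E × (Fin m → E) => fun i : Fin (m + 1) =>
      p.1 + r • (Fin.cons 0 p.2 : Fin (m + 1) → E) i := by
    have : Measurable fun p : E × (Fin m → E) => (Fin.cons 0 p.2 : Fin (m + 1) → E) :=
      hcons.comp (measurable_const.prodMk measurable_snd)
    refine measurable_pi_iff.2 fun i => ?_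
    exact measurable_fst.add (((measurable_pi_apply i).comp this).const_smul r)
  have hfin : Module.finrank ℝ (Fin m → E) = d * m := by
    rw [Module.finrank_pi_fintype]
    simp [mul_comm]
  calc ∫⁻ y, G y = ∫⁻ p : E × (Fin m → E), G (Fin.cons p.1 p.2) := by
        rw [← hmp.lintegral_comp hG]
        refine lintegral_congr fun p => ?_
        congr 1
        exact Fin.insertNth_zero' p.1 p.2
    _ = ∫⁻ x : E, ∫⁻ z : Fin m → E, G (Fin.cons x z) := by
        exact lintegral_prod (fun p : E × (Fin m → E) => G (Fin.cons p.1 p.2))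
          (hG.comp hcons).aemeasurable
    _ = ∫⁻ x : E, ENNReal.ofReal (r ^ (d * m)) * ∫⁻ z : Fin m → E,
          G fun i => x + r • (Fin.cons 0 z : Fin (m + 1) → E) i := by
        refine lintegral_congr fun x => ?_
        rw [lintegral_comp_add_smul volume (fun z : Fin m → E => G (Fin.cons x z)) (fun _ => x) hr,
          hfin]
        congr 1
        refine lintegral_congr fun z => ?_
        congr 1
        ext i
        refine Fin.cases ?_ (fun j => ?_) i <;> simp
    _ = ENNReal.ofReal (r ^ (d * m)) * ∫⁻ x : E, ∫⁻ z : Fin m → E,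
          G fun i => x + r • (Fin.cons 0 z : Fin (m + 1) → E) i :=
        lintegral_const_mul _ (hG.comp hshift).lintegral_prod_right'
    _ = _ := by
        rw [lintegral_lintegral_swap (f := fun (x : E) (z : Fin m → E) =>
          G fun i => x + r • (Fin.cons 0 z : Fin (m + 1) → E) i) (hG.comp hshift).aemeasurable]

/-- The shapes of empty simplices with respect to `1`, with one vertex at the origin. -/
def unitSimplexShapes (d m : ℕ) : Set (Fin m → EuclideanSpace ℝ (Fin d)) :=
  {z | IsEmptySimplex 1 Finset.univ (Fin.cons 0 z : Fin (m + 1) → EuclideanSpace ℝ (Fin d))}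

lemma measurable_cons_zero (m : ℕ) :
    Measurable fun z : Fin m → E => (Fin.cons 0 z : Fin (m + 1) → E) := by
  refine measurable_pi_iff.2 (Fin.cases ?_ fun i => ?_)
  · simp
  · simp only [Fin.cons_succ]
    fun_prop

lemma measurableSet_unitSimplexShapes (d m : ℕ) : MeasurableSet (unitSimplexShapes d m) :=
  (measurableSet_isEmptySimplex 1 Finset.univ).preimage (measurable_cons_zero m)

/-- There are at least three vertices, so every vertex is within `2` of the one at the origin. -/
lemma volume_unitSimplexShapes_ne_top {m : ℕ} (hm : 2 ≤ m) :
    volume (unitSimplexShapes d m) ≠ ∞ := by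
  have hsub : unitSimplexShapes d m ⊆ Set.univ.pi fun _ => Metric.closedBall 0 2 := by
    intro z hz i _
    have h := hz.dist_le (by simpa using by omega) (Finset.mem_univ i.succ) (Finset.mem_univ 0)
    simpa using h
  refine ne_top_of_le_ne_top ?_ (measure_mono hsub)
  exact (isCompact_univ_pi fun _ => isCompact_closedBall _ _).measure_lt_top.ne

lemma muA_succ {m : ℕ} (f : E → ℝ) (A : Set E) :
    muA (m + 1) f A = (∫ x in A, f x ^ (m + 1)) * volume.real (unitSimplexShapes d m) :=
  congrArg _ (integral_indicator_one (measurableSet_unitSimplexShapes d m))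

variable {f : EuclideanSpace ℝ (Fin d) → ℝ} {M : ℝ} {A : Set (EuclideanSpace ℝ (Fin d))}

lemma measurable_shapeIntegral {m : ℕ} (hA : MeasurableSet A) (hfm : Measurable f) (r : ℝ) :
    Measurable fun z : Fin m → E => shapeIntegral f A (Fin.cons 0 z : Fin (m + 1) → E) r := by
  have h1 : Measurable fun p : (Fin (m + 1) → E) × E =>
      {p : (Fin (m + 1) → E) × E | LeftMostIn A Finset.univ fun i => p.2 + r • p.1 i}.indicator
        (fun p => ∏ i, f (p.2 + r • p.1 i)) p :=
    (Finset.measurable_fun_prod _ fun i _ => hfm.comp (by fun_prop)).indicator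
      (measurableSet_leftMostIn_shape hA r)
  exact (h1.stronglyMeasurable.integral_prod_right' (ν := volume)).measurable.comp
    (measurable_cons_zero m)

/-- In the coordinates `x + r z`, being an empty simplex depends on `z` only, so the inner integral
over `x` is the shape integral. -/
lemma pi_simplexSet_eq {m : ℕ} (hA : MeasurableSet A) (hf : Integrable f) (hfm : Measurable f)
    (hf0 : ∀ x, 0 ≤ f x) (hfM : ∀ x, f x ≤ M)
    [SigmaFinite (volume.withDensity fun x => ENNReal.ofReal (f x))] {r : ℝ} (hr : 0 < r) :
    (Measure.pi fun _ : Fin (m + 1) => volume.withDensity fun x => ENNReal.ofReal (f x))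
        (simplexSet (Fin (m + 1)) r A) =
      ENNReal.ofReal (r ^ (d * m)) * ∫⁻ z in unitSimplexShapes d m,
        ENNReal.ofReal (shapeIntegral f A (Fin.cons 0 z : Fin (m + 1) → E) r) := by
  have hΦ : MeasurableSet (simplexSet (Fin (m + 1)) r A) := measurableSet_simplexSet r hA
  have hg : Measurable fun y : Fin (m + 1) → E => ENNReal.ofReal (∏ i, f (y i)) :=
    (Finset.measurable_fun_prod _ fun i _ => hfm.comp (measurable_pi_apply i)).ennreal_ofReal
  rw [pi_withDensity_ofReal volume hf hf0, withDensity_apply _ hΦ, ← lintegral_indicator hΦ,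
    ← volume_pi, lintegral_fin_succ_scaling (hg.indicator hΦ) hr,
    ← lintegral_indicator (measurableSet_unitSimplexShapes d m)]
  congr 1
  refine lintegral_congr fun z => ?_
  set w : Fin (m + 1) → E := Fin.cons 0 z with hw
  have hw0 : w 0 = 0 := rfl
  by_cases hz : z ∈ unitSimplexShapes d m
  · rw [Set.indicator_of_mem hz, shapeIntegral, ofReal_integral_eq_lintegral_ofReal
      ((integrable_prod_shape hf hfm hf0 hfM hw0 r).indicator
        (measurableSet_leftMostIn_shape_right hA w r))
      (ae_of_all _ fun x => Set.indicator_nonneg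
        (fun x _ => Finset.prod_nonneg fun i _ => hf0 _) x)]
    refine lintegral_congr fun x => ?_
    have hes : IsEmptySimplex r Finset.univ (fun i => x + r • w i) :=
      (isEmptySimplex_add_smul hr x w).2 hz
    by_cases hx : LeftMostIn A Finset.univ fun i => x + r • w i
    · rw [Set.indicator_of_mem (show (fun i => x + r • w i) ∈ simplexSet (Fin (m + 1)) r A from
        ⟨hes, hx⟩), Set.indicator_of_mem (show x ∈ {x | LeftMostIn A Finset.univ
          fun i => x + r • w i} from hx)]
    · rw [Set.indicator_of_notMem (show (fun i => x + r • w i) ∉ simplexSet (Fin (m + 1)) r A from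
        fun h => hx h.2), Set.indicator_of_notMem (show x ∉ {x | LeftMostIn A Finset.univ
          fun i => x + r • w i} from hx), ENNReal.ofReal_zero]
  · rw [Set.indicator_of_notMem hz]
    refine (lintegral_congr fun x => Set.indicator_of_notMem (fun h => hz ?_) _).trans
      lintegral_zero
    exact (isEmptySimplex_add_smul hr x w).1 h.1

/-- The asymptotic probability that `m + 1` given points form an empty simplex with left-most
point in `A`. -/
lemma tendsto_pi_simplexSet {m : ℕ} (hm : 2 ≤ m) (hA : IsOpen A) (hA_bdry : volume (frontier A) = 0)
    (hf : Integrable f) (hfm : Measurable f) (hf0 : ∀ x, 0 ≤ f x) (hfM : ∀ x, f x ≤ M)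
    [SigmaFinite (volume.withDensity fun x => ENNReal.ofReal (f x))] {r : ℕ → ℝ}
    (hr_pos : ∀ n, 1 ≤ n → 0 < r n) (hr : Tendsto r atTop (𝓝 0)) :
    Tendsto (fun n => (r n ^ (d * m))⁻¹ *
        (Measure.pi fun _ : Fin (m + 1) => volume.withDensity fun x => ENNReal.ofReal (f x)).real
          (simplexSet (Fin (m + 1)) (r n) A)) atTop (𝓝 (muA (m + 1) f A)) := by
  have hlim : Tendsto (fun n => ∫⁻ z in unitSimplexShapes d m,
      ENNReal.ofReal (shapeIntegral f A (Fin.cons 0 z : Fin (m + 1) → E) (r n))) atTop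
      (𝓝 (∫⁻ _z in unitSimplexShapes d m, ENNReal.ofReal (∫ x in A, f x ^ (m + 1)))) := by
    -- The bound is constant in the shape, and integrable because the shapes have finite volume.
    refine tendsto_lintegral_of_dominated_convergence
      (fun _ => ENNReal.ofReal ((∫ x, f x) * M ^ m))
      (fun n => (measurable_shapeIntegral hA.measurableSet hfm (r n)).ennreal_ofReal)
      (fun n => ae_of_all _ fun z => ENNReal.ofReal_le_ofReal
        (shapeIntegral_le hA.measurableSet hf hfm hf0 hfM rfl (r n))) ?_
      (ae_of_all _ fun z => ENNReal.tendsto_ofReal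
        (tendsto_shapeIntegral hA hA_bdry hf hfm hf0 hfM rfl hr))
    rw [setLIntegral_const]
    exact ENNReal.mul_ne_top ENNReal.ofReal_ne_top (volume_unitSimplexShapes_ne_top hm)
  rw [setLIntegral_const] at hlim
  have hlim' := (ENNReal.tendsto_toReal (ENNReal.mul_ne_top ENNReal.ofReal_ne_top
    (volume_unitSimplexShapes_ne_top (d := d) hm))).comp hlim
  rw [ENNReal.toReal_mul, ENNReal.toReal_ofReal (integral_nonneg fun x => pow_nonneg (hf0 x) _),
    ← measureReal_def, ← muA_succ] at hlim'
  refine hlim'.congr' ?_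
  filter_upwards [eventually_ge_atTop 1] with n hn
  have hrn := hr_pos n hn
  rw [measureReal_def, pi_simplexSet_eq hA.measurableSet hf hfm hf0 hfM hrn, ENNReal.toReal_mul,
    ENNReal.toReal_ofReal (by positivity), inv_mul_cancel_left₀ (by positivity)]
  rfl

lemma exists_measureReal_closedBall_le (hf0 : ∀ x, 0 ≤ f x)
    (hfM : ∀ x, f x ≤ M) :
    ∃ C : ℝ, ∀ (x : E) (r : ℝ), 0 ≤ r →
      (volume.withDensity fun x => ENNReal.ofReal (f x)).real (Metric.closedBall x (8 * r)) ≤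
        C * r ^ d := by
  refine ⟨M * 8 ^ d * volume.real (Metric.ball (0 : E) 1), fun x r hr => ?_⟩
  have hM : 0 ≤ M := (hf0 0).trans (hfM 0)
  have h1 : (volume.withDensity fun x => ENNReal.ofReal (f x)) (Metric.closedBall x (8 * r)) ≤
      ENNReal.ofReal M * (ENNReal.ofReal ((8 * r) ^ d) * volume (Metric.ball (0 : E) 1)) := by
    rw [withDensity_apply _ Metric.isClosed_closedBall.measurableSet]
    refine (lintegral_mono fun x => ENNReal.ofReal_le_ofReal (hfM x)).trans_eq ?_
    rw [setLIntegral_const, Measure.addHaar_closedBall _ _ (by positivity),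
      finrank_euclideanSpace_fin]
  refine (ENNReal.toReal_mono (by finiteness) h1).trans_eq ?_
  rw [ENNReal.toReal_mul, ENNReal.toReal_mul, ENNReal.toReal_ofReal hM,
    ENNReal.toReal_ofReal (by positivity), measureReal_def]
  ring

end ScalingLimit

end RandomCech

/-! ### Assembling the limits of mean and variance. -/

/-- For `n ≥ 1`, `r n ^ d ≤ n * r n ^ d`; a `d`-th root is then taken. -/
lemma tendsto_zero_of_tendsto_mul_pow {d : ℕ} (hd : 1 ≤ d) {r : ℕ → ℝ}
    (hr_pos : ∀ n, 1 ≤ n → 0 < r n)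
    (hr_sparse : Tendsto (fun n : ℕ => (n : ℝ) * r n ^ d) atTop (𝓝 0)) :
    Tendsto r atTop (𝓝 0) := by
  have h1 : Tendsto (fun n => r n ^ d) atTop (𝓝 0) := by
    refine squeeze_zero' ?_ ?_ hr_sparse
    · filter_upwards [eventually_ge_atTop 1] with n hn
      exact pow_nonneg (hr_pos n hn).le d
    · filter_upwards [eventually_ge_atTop 1] with n hn
      exact le_mul_of_one_le_left (pow_nonneg (hr_pos n hn).le d) (by exact_mod_cast hn)
  have h2 := h1.rpow_const (p := (d : ℝ)⁻¹) (Or.inr (by positivity))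
  rw [Real.zero_rpow (by positivity)] at h2
  refine h2.congr' ?_
  filter_upwards [eventually_ge_atTop 1] with n hn
  exact Real.pow_rpow_inv_natCast (hr_pos n hn).le (by omega)

theorem lemma3p9 {d k : ℕ} (hd : 1 ≤ d) (hk : 3 ≤ k)
    {Ω : Type*} [MeasurableSpace Ω] (P : Measure Ω) [IsProbabilityMeasure P]
    -- a bounded probability density on `ℝ^d`
    (f : EuclideanSpace ℝ (Fin d) → ℝ) (hf_meas : Measurable f) (hf_nonneg : ∀ x, 0 ≤ f x)
    (hf_bdd : ∃ M : ℝ, ∀ x, f x ≤ M)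
    -- i.i.d. points with density `f`
    (X : ℕ → Ω → EuclideanSpace ℝ (Fin d)) (hX_meas : ∀ i, Measurable (X i))
    (hX_indep : iIndepFun X P)
    (hX_law : ∀ i, P.map (X i) = volume.withDensity (fun x => ENNReal.ofReal (f x)))
    -- an independent Poisson number of points with mean `n`
    (N : ℕ → Ω → ℕ) (hN_meas : ∀ n, 1 ≤ n → Measurable (N n))
    (hN_law : ∀ n, 1 ≤ n → P.map (N n) = poissonMeasure (n : NNReal))
    (hN_indep : ∀ n, 1 ≤ n → IndepFun (N n) (fun ω i => X i ω) P)
    -- radii in the sparse regime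
    (r : ℕ → ℝ) (hr_pos : ∀ n, 1 ≤ n → 0 < r n)
    (hr_sparse : Tendsto (fun n : ℕ => (n : ℝ) * r n ^ d) atTop (𝓝 0))
    (A : Set (EuclideanSpace ℝ (Fin d))) (hA : IsOpen A) (hA_bdry : volume (frontier A) = 0) :
    (∀ n, 1 ≤ n →
      MemLp (fun ω => (RandomCech.isolatedCount k (r n) A (fun i => X i ω) (N n ω) : ℝ)) 2 P) ∧
    Tendsto (fun n : ℕ => ((n : ℝ) ^ k)⁻¹ * (r n ^ (d * (k - 1)))⁻¹ *
        ∫ ω, (RandomCech.isolatedCount k (r n) A (fun i => X i ω) (N n ω) : ℝ) ∂P)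
      atTop (𝓝 (RandomCech.muA k f A / (k.factorial : ℝ))) ∧
    Tendsto (fun n : ℕ => ((n : ℝ) ^ k)⁻¹ * (r n ^ (d * (k - 1)))⁻¹ *
        variance
          (fun ω => (RandomCech.isolatedCount k (r n) A (fun i => X i ω) (N n ω) : ℝ)) P)
      atTop (𝓝 (RandomCech.muA k f A / (k.factorial : ℝ))) := by
  obtain ⟨M, hfM⟩ := hf_bdd
  obtain ⟨m, rfl⟩ : ∃ m, k = m + 1 := ⟨k - 1, by omega⟩
  have hm : 2 ≤ m := by omega
  rw [Nat.add_sub_cancel]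
  set ν : Measure (EuclideanSpace ℝ (Fin d)) := volume.withDensity fun x => ENNReal.ofReal (f x)
    with hν
  have hνprob : IsProbabilityMeasure ν := by
    rw [← hX_law 0]
    exact Measure.isProbabilityMeasure_map (hX_meas 0).aemeasurable
  -- The integral of `f` is the total mass of `ν`, the law of `X 0`.
  have hf : Integrable f := by
    refine ⟨hf_meas.aestronglyMeasurable, ?_⟩
    rw [hasFiniteIntegral_iff_ofReal (ae_of_all _ hf_nonneg), ← setLIntegral_univ,
      ← withDensity_apply _ MeasurableSet.univ]
    exact measure_lt_top ν _
  have hr0 := tendsto_zero_of_tendsto_mul_pow hd hr_pos hr_sparse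
  obtain ⟨C, hC⟩ := RandomCech.exists_measureReal_closedBall_le hf_nonneg hfM
  have hmom := fun n hn => RandomCech.moments_isolatedCount hX_meas hX_indep hX_law (hN_meas n hn)
    (hN_law n hn) (hN_indep n hn) hk (r n) hA.measurableSet
  simp only [NNReal.coe_natCast] at hmom
  have hI := RandomCech.tendsto_pi_simplexSet hm hA hA_bdry hf hf_meas hf_nonneg hfM hr_pos hr0
  rw [← hν] at hI
  set I : ℕ → ℝ := fun n => (Measure.pi fun _ : Fin (m + 1) => ν).real
    (RandomCech.simplexSet (Fin (m + 1)) (r n) A) with hI_def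
  set J : ℕ → ℝ := fun n => ∫ y in RandomCech.simplexSet (Fin (m + 1)) (r n) A,
    Real.exp (-n * ν.real (RandomCech.nearby (r n) y)) ∂(Measure.pi fun _ : Fin (m + 1) => ν)
    with hJ_def
  have hfac : ((m + 1).factorial : ℝ) ≠ 0 := by positivity
  -- `J n` lies between `I n` and `I n` times an exponential whose exponent is a multiple of `n * r
  -- n ^ d`.
  have hJ : Tendsto (fun n => (r n ^ (d * m))⁻¹ * J n) atTop (𝓝 (RandomCech.muA (m + 1) f A)) := by
    have hexp : Tendsto (fun n : ℕ => Real.exp (-(n : ℝ) * ((m + 1 : ℕ) * (C * r n ^ d)))) atTop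
        (𝓝 1) := by
      have h := (hr_sparse.const_mul (-((m + 1 : ℕ) * C))).rexp
      rw [mul_zero, Real.exp_zero] at h
      exact h.congr fun n => by ring_nf
    have hlow := hexp.mul hI
    rw [one_mul] at hlow
    refine tendsto_of_tendsto_of_tendsto_of_le_of_le' hlow hI ?_ ?_ <;>
    · filter_upwards [eventually_ge_atTop 1] with n hn
      have hrn := hr_pos n hn
      have hb := RandomCech.mean_integral_bounds (ν := ν) (k := m + 1) hrn.le hA.measurableSet
        (Nat.cast_nonneg n) (fun x => hC x (r n) hrn.le)
      first
        | exact mul_le_mul_of_nonneg_left hb.2 (by positivity)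
        | exact (mul_left_comm _ _ _).trans_le (mul_le_mul_of_nonneg_left hb.1 (by positivity))
  have hmean : Tendsto (fun n : ℕ => ((n : ℝ) ^ (m + 1))⁻¹ * (r n ^ (d * m))⁻¹ *
      ∫ ω, (RandomCech.isolatedCount (m + 1) (r n) A (fun i => X i ω) (N n ω) : ℝ) ∂P)
      atTop (𝓝 (RandomCech.muA (m + 1) f A / ((m + 1).factorial : ℝ))) := by
    refine (hJ.div_const _).congr' ?_
    filter_upwards [eventually_ge_atTop 1] with n hn
    have hn0 : (n : ℝ) ^ (m + 1) ≠ 0 := by positivity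
    have hr1 := (pow_pos (hr_pos n hn) (d * m)).ne'
    have h : _ = (n : ℝ) ^ (m + 1) * J n := (hmom n hn).2.1
    rw [eq_div_of_mul_eq hfac ((mul_comm _ _).trans h)]
    field_simp
  refine ⟨fun n hn => (hmom n hn).1, hmean, ?_⟩
  -- The decoupling error carries `n^(2k)`. One `n^k` is normalised away and the other joins `(C
  -- r^d)^k` to give `(C n r^d)^k → 0`, while `I n / r^(dm)` converges.
  have herr : Tendsto (fun n : ℕ => ((n : ℝ) ^ (m + 1))⁻¹ * (r n ^ (d * m))⁻¹ *
      (variance (fun ω =>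
          (RandomCech.isolatedCount (m + 1) (r n) A (fun i => X i ω) (N n ω) : ℝ)) P -
        ∫ ω, (RandomCech.isolatedCount (m + 1) (r n) A (fun i => X i ω) (N n ω) : ℝ) ∂P))
      atTop (𝓝 0) := by
    have hlim := (hI.mul ((hr_sparse.const_mul C).pow (m + 1))).div_const
      (((m + 1).factorial : ℝ) ^ 2)
    rw [mul_zero, zero_pow (Nat.succ_ne_zero m), mul_zero, zero_div] at hlim
    refine squeeze_zero_norm' ?_ hlim
    filter_upwards [eventually_ge_atTop 1] with n hn
    have hrn := hr_pos n hn
    have hn0 : (0 : ℝ) < (n : ℝ) ^ (m + 1) := by positivity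
    have h := (hmom n hn).2.2
    have hb := RandomCech.abs_pair_sub_sq_le (ν := ν) hk hrn.le hA.measurableSet
      (Nat.cast_nonneg n) (fun x => hC x (r n) hrn.le)
    rw [eq_div_of_mul_eq (pow_ne_zero 2 hfac) ((mul_comm _ _).trans h), Real.norm_eq_abs, abs_mul,
      abs_of_pos (by positivity : (0 : ℝ) < ((n : ℝ) ^ (m + 1))⁻¹ * (r n ^ (d * m))⁻¹), abs_div,
      abs_mul, abs_of_pos (by positivity : (0 : ℝ) < ((n : ℝ) ^ (m + 1)) ^ 2),
      abs_of_pos (by positivity : (0 : ℝ) < ((m + 1).factorial : ℝ) ^ 2)]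
    calc _ ≤ ((n : ℝ) ^ (m + 1))⁻¹ * (r n ^ (d * m))⁻¹ *
          (((n : ℝ) ^ (m + 1)) ^ 2 * (I n * (C * r n ^ d) ^ (m + 1)) /
            ((m + 1).factorial : ℝ) ^ 2) := by gcongr
      _ = (r n ^ (d * m))⁻¹ * I n * (C * (n * r n ^ d)) ^ (m + 1) /
            ((m + 1).factorial : ℝ) ^ 2 := by
        have e : C * (n * r n ^ d) = n * (C * r n ^ d) := by ring
        have hr1 := (pow_pos hrn (d * m)).ne'
        rw [e, mul_pow (n : ℝ)]
        field_simp
  have := hmean.add herr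
  rw [add_zero] at this
  exact this.congr fun n => by ring
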